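/- **Model.** Fix $n\ge 1$ and let $\mathbb R^{n\times n}$ carry the Frobenius inner product and norm. For every $\epsilon\in(0,1)$ consider an $n\times n$ input-queued switch in discrete time: $q(t),a(t)\in\mathbb Z_{\ge0}^{n\times n}$ are the queue lengths and arrivals in slot $t$, the schedule $s(t)$ is an $n\times n$ permutation matrix chosen by a (possibly randomized) scheduling algorithm, and $q_{ij}(t+1)=\max(0,\,q_{ij}(t)+a_{ij}(t)-s_{ij}(t))$. Let $\tilde{\mathcal H}_t=(q(0),s(0),\dots,q(t),s(t))$. *Arrivals.* For each $(i,j)$ the $a_{ij}(t)$, $t\ge0$, are i.i.d.; in each slot $a_{ij}(t)$ and $a_{i'j'}(t)$ are independent for $(i,j)\ne(i',j')$; $a(t)$ is independent of $\tilde{\mathcal H}_t$; $a_{ij}(t)\le a_{\max}$ with $a_{\max}$ independent of $\epsilon$; and $\mathbb P(a(t)=0)>0$. The mean is $\mathbb E[a(t)]=\lambda=(1-\epsilon)\nu$, where $\nu$ is a fixed doubly stochastic matrix with all entries positive, and the variances satisfy $\operatorname{Var}(a_{ij}(t))\to\tilde\sigma_{ij}^2$ as $\epsilon\downarrow0$.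 *Markov chain.* The switch is described by a time-homogeneous Markov chain $X(t)$ on a countable state space. Conditions: (A.1) $X(t)$ is $\sigma(\tilde{\mathcal H}_t)$-measurable, and the chain is irreducible and aperiodic; (A.2) $q(t)=g(X(t))$ for a function $g$ under which preimages of finite sets are finite. The switch is *stable* if $X(t)$ is positive recurrent. $\bar q$ denotes the limit in distribution of $q(t)$ as $t\to\infty$. *Cone.* $\mathcal K=\{x\in\mathbb R_{+}^{n\times n}: x_{ij}=w_i+\tilde w_j \text{ for some } w,\tilde w\in\mathbb R^n\}$, and $x_{\perp\mathcal K}=x-x_{\|\mathcal K}$, where $x_{\|\mathcal K}$ is the point of $\mathcal K$ nearest to $x$. *Class.* The algorithm lies in $\Pi_1(\nu)$ if (A.1) and (A.2) hold for every $\epsilon\in(0,1)$ and there is $W_1>0$, independent of $\epsilon$, such that for all $t\ge 0$ and all states $x$ with $\mathbb P(X(t)=x)>0$, with $q=g(x)$, $$\mathbb E[\langle q(t),s(t)\rangle\mid X(t)=x]\ \ge\ \langle q,\nu\rangle+W_1\|q_{\perp\mathcal K}\|.$$ **Theorem.** Suppose that the algorithm lies in $\Pi_1(\nu)$. Then it achieves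 state-space collapse: for every $\epsilon\in(0,1)$ the switch is stable (and (A.1), (A.2) hold), and there are $\epsilon_0>0$ and constants $C_r<\infty$, $r=1,2,\dots$, independent of $\epsilon$, such that for all $0<\epsilon\le\epsilon_0$ with $\epsilon<1$ the limit $\bar q$ exists and $$\mathbb E\big[\|\bar q_{\perp\mathcal K}\|^r\big]\le C_r\qquad\text{for all } r\in\{1,2,\dots\}.$$ Moreover its heavy-traffic behaviour is MaxWeight-like: for every $\epsilon\in(0,1)$ the limit $\bar q$ exists, $\mathbb E[\sum_{ij}\bar q_{ij}]<\infty$, and $$\lim_{\epsilon\downarrow0}\ \epsilon\,\mathbb E\Big[\sum_{ij}\bar q_{ij}\Big]=\Big(1-\frac1{2n}\Big)\|\tilde\sigma\|^2,\qquad \|\tilde\sigma\|^2=\sum_{ij}\tilde\sigma_{ij}^2 .$$ -/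

import Mathlib

open MeasureTheory ProbabilityTheory Filter Topology

universe u v

noncomputable section

namespace Switch

/-! ### Geometry of `ℝ^{n × n}` with the Frobenius inner product -/

/-- `ℝ^{n × n}` with the Frobenius inner product and norm. -/
abbrev Vec (n : ℕ) : Type := EuclideanSpace ℝ (Fin n × Fin n)

/-- Matrices of natural numbers (queue lengths, arrivals, schedules). -/
abbrev NMat (n : ℕ) : Type := Fin n → Fin n → ℕ

/-- A real matrix as a vector of `ℝ^{n × n}`. -/
def vec {n : ℕ} (M : Fin n → Fin n → ℝ) : Vec n := WithLp.toLp 2 fun p => M p.1 p.2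

/-- A matrix of natural numbers as a vector of `ℝ^{n × n}`. -/
def natVec {n : ℕ} (M : NMat n) : Vec n := vec fun i j => (M i j : ℝ)

/-- The subspace `𝒮`: linear combinations `∑ᵢ wᵢ eⁱ + ∑ⱼ w̃ⱼ ẽʲ`, where `eⁱ` is the indicator of
row `i` and `ẽʲ` the indicator of column `j`; its `(i, j)` entry is `wᵢ + w̃ⱼ`. -/
def spaceS (n : ℕ) : Submodule ℝ (Vec n) where
  carrier := {x | ∃ w w' : Fin n → ℝ, ∀ i j, x (i, j) = w i + w' j}
  add_mem' := by
    rintro x y ⟨w, w', hx⟩ ⟨v, v', hy⟩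
    refine ⟨w + v, w' + v', fun i j => ?_⟩
    simp only [PiLp.add_apply, hx, hy, Pi.add_apply]
    ring
  zero_mem' := ⟨0, 0, fun i j => by simp⟩
  smul_mem' := by
    rintro c x ⟨w, w', hx⟩
    refine ⟨c • w, c • w', fun i j => ?_⟩
    simp only [PiLp.smul_apply, hx, Pi.smul_apply, smul_eq_mul]
    ring

/-- The cone `𝒦 = 𝒮 ∩ ℝ₊^{n × n}`. -/
def coneK (n : ℕ) : Set (Vec n) := {x | x ∈ spaceS n ∧ ∀ p, 0 ≤ x p}

theorem isClosed_coneK (n : ℕ) : IsClosed (coneK n) := by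
  have h1 : IsClosed ((spaceS n : Submodule ℝ (Vec n)) : Set (Vec n)) :=
    Submodule.closed_of_finiteDimensional _
  have h2 : IsClosed {x : Vec n | ∀ p, 0 ≤ x p} := by
    simp only [Set.ofPred_forall]
    exact isClosed_iInter fun p => isClosed_le continuous_const (by fun_prop)
  exact h1.inter h2

theorem exists_projK {n : ℕ} (x : Vec n) :
    ∃ y, y ∈ coneK n ∧ ∀ z ∈ coneK n, ‖x - y‖ ≤ ‖x - z‖ := by
  have hne : (coneK n).Nonempty := ⟨0, (spaceS n).zero_mem, fun p => by simp⟩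
  obtain ⟨y, hy, hxy⟩ := (isClosed_coneK n).exists_infDist_eq_dist hne x
  refine ⟨y, hy, fun z hz => ?_⟩
  rw [← dist_eq_norm, ← dist_eq_norm, ← hxy]
  exact Metric.infDist_le_dist_of_mem hz

/-- The projection `x_{∥𝒦}` of `x` onto the cone: the (unique) nearest point of `𝒦`. -/
def projK {n : ℕ} (x : Vec n) : Vec n := (exists_projK x).choose

/-- `x_{⊥𝒦} = x - x_{∥𝒦}`. -/
def perpK {n : ℕ} (x : Vec n) : Vec n := x - projK x

/-- A schedule is a permutation matrix (a perfect matching of inputs with outputs). -/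
def IsSchedule {n : ℕ} (m : NMat n) : Prop :=
  ∃ τ : Equiv.Perm (Fin n), ∀ i j, m i j = if τ i = j then 1 else 0

/-! ### Transition probabilities on a countable state space -/

/-- The `k`-step transition probabilities of the transition matrix `P`. -/
def stepDist {A : Type v} (P : A → PMF A) : ℕ → A → PMF A
  | 0, x => PMF.pure x
  | k + 1, x => (P x).bind (stepDist P k)

/-- Every state can be reached from every state. -/
def Irreducible {A : Type v} (P : A → PMF A) : Prop :=
  ∀ x y, ∃ k, stepDist P k x y ≠ 0

/-- For every state, the only common divisor of its possible return times is `1`. -/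
def Aperiodic {A : Type v} (P : A → PMF A) : Prop :=
  ∀ x, ∀ d : ℕ, (∀ k, 1 ≤ k → stepDist P k x x ≠ 0 → d ∣ k) → d = 1

open Classical in
/-- `avoidProb P x k y` is the probability that the chain started in `y` is not in `x` at any of
the times `1, …, k`. -/
def avoidProb {A : Type v} (P : A → PMF A) (x : A) : ℕ → A → ENNReal
  | 0, _ => 1
  | k + 1, y => ∑' z, if z = x then 0 else P y z * avoidProb P x k z

/-- The mean return time `𝔼ₓ[τₓ] = ∑_{k ≥ 0} ℙₓ(τₓ > k)` to the state `x`, where `τₓ` is the first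
time `t ≥ 1` at which the chain is in `x` (infinite if `τₓ = ∞` with positive probability). -/
def meanReturnTime {A : Type v} (P : A → PMF A) (x : A) : ENNReal := ∑' k, avoidProb P x k x

/-- All mean return times are finite. -/
def PositiveRecurrent {A : Type v} (P : A → PMF A) : Prop := ∀ x, meanReturnTime P x < ⊤

/-! ### The switch -/

/-- The `σ`-algebra generated by `q(0), s(0), …, q(t), s(t)`. -/
abbrev historySigma {Ω : Type u} {n : ℕ} (q s : ℕ → Ω → NMat n) (t : ℕ) : MeasurableSpace Ω :=
  ⨆ k ∈ Set.Iic t, (MeasurableSpace.comap (q k) inferInstance ⊔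
    MeasurableSpace.comap (s k) inferInstance)

/-- An `n × n` input-queued switch run by some (possibly randomized) scheduling algorithm,
together with a Markov chain describing it. -/
structure SwitchSystem (n : ℕ) where
  /-- the probability space -/
  Ω : Type u
  [mΩ : MeasurableSpace Ω]
  μ : Measure Ω
  [isProb : IsProbabilityMeasure μ]
  /-- arrivals `a(t)`, schedules `s(t)` and queue lengths `q(t)` -/
  a : ℕ → Ω → NMat n
  s : ℕ → Ω → NMat n
  q : ℕ → Ω → NMat n
  measurable_a : ∀ t, Measurable (a t)
  measurable_s : ∀ t, Measurable (s t)
  measurable_q : ∀ t, Measurable (q t)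
  isSchedule_s : ∀ t ω, IsSchedule (s t ω)
  /-- `q(t+1) = [q(t) + a(t) - s(t)]⁺`; the subtraction of natural numbers is truncated at `0`. -/
  queue_eq : ∀ t ω i j, q (t + 1) ω i j = q t ω i j + a t ω i j - s t ω i j
  /-- The algorithm does not anticipate: the arrivals of slot `t` are independent of the queue
  lengths and schedules up to and including slot `t`. -/
  nonanticipating : ∀ t, Indep (MeasurableSpace.comap (a t) inferInstance) (historySigma q s t) μ
  /-- the countable state space of the Markov chain `X(t)`, and its transition matrix -/
  A : Type v
  [countA : Countable A]
  X : ℕ → Ω → A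
  P : A → PMF A
  measurableSet_X : ∀ t x, MeasurableSet {ω | X t ω = x}
  markov : ∀ (t : ℕ) (x : ℕ → A),
    μ {ω | ∀ k ≤ t + 1, X k ω = x k} = μ {ω | ∀ k ≤ t, X k ω = x k} * P (x t) (x (t + 1))
  /-- the function that reads the queue lengths off the state of the chain -/
  g : A → NMat n

attribute [instance] SwitchSystem.mΩ SwitchSystem.isProb SwitchSystem.countA

namespace SwitchSystem

variable {n : ℕ}

/-- Assumption on the arrivals, with the bound `aMax` on the arrivals in one slot. -/
structure ArrivalAssumption (S : SwitchSystem.{u, v} n) (aMax : ℕ) : Prop where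
  indep_time : ∀ i j, iIndepFun (fun t ω => S.a t ω i j) S.μ
  ident : ∀ i j t, IdentDistrib (fun ω => S.a t ω i j) (fun ω => S.a 0 ω i j) S.μ S.μ
  indep_pairs : ∀ t i j i' j', (i, j) ≠ (i', j') →
    IndepFun (fun ω => S.a t ω i j) (fun ω => S.a t ω i' j') S.μ
  bounded : ∀ t ω i j, S.a t ω i j ≤ aMax
  noArrival : ∀ t, 0 < S.μ {ω | ∀ i j, S.a t ω i j = 0}

/-- The mean arrival rates `λᵢⱼ` (the same in all time slots). -/
def rate (S : SwitchSystem.{u, v} n) (i j : Fin n) : ℝ := ∫ ω, (S.a 0 ω i j : ℝ) ∂S.μ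

/-- The variances `σᵢⱼ²` of the arrivals (the same in all time slots). -/
def arrivalVar (S : SwitchSystem.{u, v} n) (i j : Fin n) : ℝ :=
  variance (fun ω => (S.a 0 ω i j : ℝ)) S.μ

/-- Condition A.1: `X(t)` is a function of the history up to `q(t), s(t)`, and the chain is
irreducible and aperiodic. -/
def CondA1 (S : SwitchSystem.{u, v} n) : Prop :=
  (∀ t x, MeasurableSet[historySigma S.q S.s t] {ω | S.X t ω = x}) ∧
    Irreducible S.P ∧ Aperiodic S.P

/-- Condition A.2: `q(t) = g(X(t))`, and preimages of finite sets under `g` are finite. -/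
def CondA2 (S : SwitchSystem.{u, v} n) : Prop :=
  (∀ t ω, S.q t ω = S.g (S.X t ω)) ∧ ∀ B : Set (NMat n), B.Finite → (S.g ⁻¹' B).Finite

/-- The switch is stable if its Markov chain is positive recurrent. -/
def Stable (S : SwitchSystem.{u, v} n) : Prop := PositiveRecurrent S.P

/-- `ρ` is the steady-state law, that is the law of the limit in distribution `q̄` of `q(t)`. -/
def IsSteadyState (S : SwitchSystem.{u, v} n) (ρ : ProbabilityMeasure (NMat n)) : Prop :=
  TendstoInDistribution S.q atTop id (fun _ => S.μ) (ρ : Measure (NMat n))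

end SwitchSystem

/-! ### Heavy traffic: a family of switches indexed by `ε ∈ (0, 1)`

The values of the family outside `(0, 1)` play no role. -/

/-- Mean arrival rates `(1 - ε) ν` with `ν` doubly stochastic and positive, and variances that
converge to `σ̃²` as `ε ↓ 0`. -/
structure HeavyTraffic {n : ℕ} (S : ℝ → SwitchSystem.{u, v} n) (ν : Matrix (Fin n) (Fin n) ℝ)
    (σt : Fin n → Fin n → ℝ) : Prop where
  doublyStoch : ν ∈ doublyStochastic ℝ (Fin n)
  pos : ∀ i j, 0 < ν i j
  rate_eq : ∀ ε ∈ Set.Ioo (0 : ℝ) 1, ∀ i j, (S ε).rate i j = (1 - ε) * ν i j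
  tendsto_var : ∀ i j, Tendsto (fun ε => (S ε).arrivalVar i j) (𝓝[>] 0) (𝓝 (σt i j ^ 2))

/-- The class `Π₁(ν)`: conditions A.1 and A.2 hold, and
`𝔼[⟨q(t), s(t)⟩ | X(t) = x] ≥ ⟨q, ν⟩ + W₁ ‖q_{⊥𝒦}‖` with `q = g(x)`, where `W₁ > 0` does not depend
on `ε` (for all `t` and all `x` for which the event `X(t) = x` has positive probability). -/
def InClassOne {n : ℕ} (S : ℝ → SwitchSystem.{u, v} n) (ν : Matrix (Fin n) (Fin n) ℝ) : Prop :=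
  (∀ ε ∈ Set.Ioo (0 : ℝ) 1, (S ε).CondA1 ∧ (S ε).CondA2) ∧
  ∃ W₁ : ℝ, 0 < W₁ ∧ ∀ ε ∈ Set.Ioo (0 : ℝ) 1, ∀ (t : ℕ) (x : (S ε).A),
    (S ε).μ {ω | (S ε).X t ω = x} ≠ 0 →
      inner ℝ (natVec ((S ε).g x)) (vec ν) + W₁ * ‖perpK (natVec ((S ε).g x))‖ ≤
        ∫ ω, inner ℝ (natVec ((S ε).q t ω)) (natVec ((S ε).s t ω))
          ∂(ProbabilityTheory.cond (S ε).μ {ω | (S ε).X t ω = x})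

/-- State-space collapse: stability, A.1, A.2, and all moments of `‖q̄_{⊥𝒦}‖` are bounded uniformly
in `ε ∈ (0, ε₀]`. -/
def AchievesSSC {n : ℕ} (S : ℝ → SwitchSystem.{u, v} n) : Prop :=
  (∀ ε ∈ Set.Ioo (0 : ℝ) 1, (S ε).Stable ∧ (S ε).CondA1 ∧ (S ε).CondA2) ∧
  ∃ ε₀ : ℝ, 0 < ε₀ ∧ ∃ C : ℕ → ℝ, ∀ ε ∈ Set.Ioo (0 : ℝ) 1, ε ≤ ε₀ →
    ∃ ρ : ProbabilityMeasure (NMat n), (S ε).IsSteadyState ρ ∧ ∀ r : ℕ, 1 ≤ r →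
      Integrable (fun m => ‖perpK (natVec m)‖ ^ r) (ρ : Measure (NMat n)) ∧
      ∫ m, ‖perpK (natVec m)‖ ^ r ∂(ρ : Measure (NMat n)) ≤ C r

/-- MaxWeight-like behaviour: the steady state exists with finite mean total queue length, and
`lim_{ε ↓ 0} ε 𝔼[∑ᵢⱼ q̄ᵢⱼ] = (1 - 1/(2n)) ‖σ̃‖²`. -/
def MaxWeightLike {n : ℕ} (S : ℝ → SwitchSystem.{u, v} n) (σt : Fin n → Fin n → ℝ) : Prop :=
  ∃ ρ : ℝ → ProbabilityMeasure (NMat n),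
    (∀ ε ∈ Set.Ioo (0 : ℝ) 1, (S ε).IsSteadyState (ρ ε) ∧
      Integrable (fun m : NMat n => ∑ i, ∑ j, (m i j : ℝ)) (ρ ε : Measure (NMat n))) ∧
    Tendsto (fun ε : ℝ => ε * ∫ m : NMat n, ∑ i, ∑ j, (m i j : ℝ) ∂(ρ ε : Measure (NMat n)))
      (𝓝[>] 0) (𝓝 ((1 - 1 / (2 * (n : ℝ))) * ‖vec σt‖ ^ 2))

end Switch

end

noncomputable section

namespace Switch

/-! ### Iterated transition probabilities -/

section Chain

variable {A : Type v}

/-! Write `Π` for the orthogonal projection onto `𝒮`, `u` for the unused service in `q' = q + a - s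
+ u`, and `q_⊥` for `perpK q`. The proof rests on three Lyapunov functions.

Stability. With `‖q‖²` the class condition and the positivity of `ν` give a drift of order `-ε‖q‖`.
Increments are bounded, so `exists_exp_drift` turns this into a geometric drift of `exp (θ‖q‖)`,
whose sublevel sets are finite by A.2. A coupling of two independent copies of the chain
(`exists_coupling_rate`) then gives convergence to an invariant law `π`, and `π` has all moments of
`‖q‖`.

Collapse. Apply the same scheme to `‖q_⊥‖`. The distance at the next step is at most the distance to
the present projection `p`. For `p ∈ 𝒦` one has `⟨p, s⟩ = ⟨p, ν⟩` for every schedule, because all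
row and column sums agree, and `⟨p, u⟩ ≥ 0`. The class condition leaves a drift `-2W‖q_⊥‖`, and for
small `ε` the perturbation `ε⟨q_⊥, ν⟩` costs at most half of it. No constant depends on `ε`, so the
moments are bounded uniformly (`exists_moment_bound`).

Mean queue length. Use `⟨Πq, q⟩` (`abs_inner_projS_step_le`). All schedules and `ν` have the same
image under `Π`, so the scheduling algorithm enters only through `u`. Under `π` the change of this
function has mean zero, which equates `(2ε/n) 𝔼[∑ q]` with `(2n-1)/n² ∑ Var(aᵢⱼ) + ε²`, up to terms
in `u`. Since `q'` is orthogonal to `u`, the cross term sees only `q'_⊥`. As `‖u‖²` has stationary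
mean `εn` and `‖q_⊥‖²` has bounded mean, Young's inequality with weight `√ε` makes the error
`O(√ε)`. Multiplying by `n/2` gives the factor `(2n-1)/(2n)`. -/

/-- The expectation of `f` after `k` steps of the chain started in `x`. -/
def stepExp (P : A → PMF A) (k : ℕ) (f : A → ENNReal) (x : A) : ENNReal :=
  ∑' y, stepDist P k x y * f y

theorem stepDist_add (P : A → PMF A) (k l : ℕ) (x : A) :
    stepDist P (k + l) x = (stepDist P k x).bind (stepDist P l) := by
  induction k generalizing x with
  | zero => simp [stepDist]
  | succ k ih =>
    rw [Nat.add_right_comm]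
    simp only [stepDist, PMF.bind_bind]
    exact congrArg _ (funext ih)

theorem stepDist_one (P : A → PMF A) : stepDist P 1 = P := by
  funext x
  simp only [stepDist]
  exact PMF.bind_pure _

theorem stepDist_succ_right (P : A → PMF A) (k : ℕ) (x : A) :
    stepDist P (k + 1) x = (stepDist P k x).bind P := by
  rw [stepDist_add, stepDist_one]

theorem tsum_bind_mul (p : PMF A) (Q : A → PMF A) (f : A → ENNReal) :
    ∑' y, p.bind Q y * f y = ∑' w, p w * ∑' y, Q w y * f y := by
  simp only [PMF.bind_apply, ← ENNReal.tsum_mul_right, ← ENNReal.tsum_mul_left]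
  rw [ENNReal.tsum_comm]
  simp only [mul_assoc]

theorem stepExp_zero (P : A → PMF A) (f : A → ENNReal) (x : A) : stepExp P 0 f x = f x := by
  classical
  simp only [stepExp, stepDist, PMF.pure_apply]
  rw [tsum_eq_single x]
  · simp
  · intro y hy
    simp [hy]

theorem stepExp_succ (P : A → PMF A) (k : ℕ) (f : A → ENNReal) (x : A) :
    stepExp P (k + 1) f x = ∑' w, P x w * stepExp P k f w :=
  tsum_bind_mul (P x) (stepDist P k) f

theorem stepExp_succ_right (P : A → PMF A) (k : ℕ) (f : A → ENNReal) (x : A) :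
    stepExp P (k + 1) f x = stepExp P k (fun w => ∑' y, P w y * f y) x := by
  simp only [stepExp, stepDist_succ_right]
  exact tsum_bind_mul _ _ _

theorem stepExp_mono (P : A → PMF A) (k : ℕ) {f h : A → ENNReal} (hfh : ∀ y, f y ≤ h y) (x : A) :
    stepExp P k f x ≤ stepExp P k h x :=
  ENNReal.tsum_le_tsum fun y => mul_le_mul_right (hfh y) _

theorem stepExp_const_mul_add (P : A → PMF A) (k : ℕ) (f : A → ENNReal) (c d : ENNReal) (x : A) :
    stepExp P k (fun y => c * f y + d) x = c * stepExp P k f x + d := by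
  simp only [stepExp, mul_add]
  rw [ENNReal.tsum_add, ENNReal.tsum_mul_right, PMF.tsum_coe, one_mul, ← ENNReal.tsum_mul_left]
  congr 1
  exact tsum_congr fun y => by ring

/-- A supersolution `K'` of `γ K' + K ≤ K'` absorbs the constants that accumulate over the steps.
Peeling off the last step lets the drift act inside the expectation. -/
theorem stepExp_le_of_drift (P : A → PMF A) {V : A → ENNReal} {γ K K' : ENNReal}
    (hK : γ * K' + K ≤ K') (hV : ∀ x, ∑' y, P x y * V y ≤ γ * V x + K) (k : ℕ) (x : A) :
    stepExp P k V x ≤ γ ^ k * V x + K' := by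
  induction k with
  | zero => simp [stepExp_zero]
  | succ k ih =>
    calc stepExp P (k + 1) V x ≤ stepExp P k (fun y => γ * V y + K) x := by
          rw [stepExp_succ_right]; exact stepExp_mono P k hV x
      _ = γ * stepExp P k V x + K := stepExp_const_mul_add ..
      _ ≤ γ * (γ ^ k * V x + K') + K := by gcongr
      _ = γ ^ (k + 1) * V x + (γ * K' + K) := by ring
      _ ≤ γ ^ (k + 1) * V x + K' := by gcongr

theorem stepDist_add_ne_zero {P : A → PMF A} {k l : ℕ} {x y z : A}
    (h₁ : stepDist P k x y ≠ 0) (h₂ : stepDist P l y z ≠ 0) : stepDist P (k + l) x z ≠ 0 := by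
  rw [stepDist_add, PMF.bind_apply]
  intro h
  have := (ENNReal.tsum_eq_zero.1 h) y
  exact mul_ne_zero h₁ h₂ this

/-- An aperiodic irreducible chain can go from any state of a finite set to a given state in a
common number of steps. -/
theorem exists_stepDist_ne_zero {P : A → PMF A} (hirr : Irreducible P) (hap : Aperiodic P) (z : A)
    {F : Set A} (hF : F.Finite) : ∃ m, 1 ≤ m ∧ ∀ y ∈ F, stepDist P m y z ≠ 0 := by
  let R : AddSubmonoid ℕ :=
    { carrier := {k | stepDist P k z z ≠ 0}
      add_mem' := fun h₁ h₂ => stepDist_add_ne_zero h₁ h₂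
      zero_mem' := by simp [stepDist] }
  -- The return times to `z` form a numerical semigroup. Aperiodicity makes its gcd equal to 1, so
  -- it contains all large integers.
  have hg : Nat.setGcd (R : Set ℕ) = 1 :=
    hap z _ fun k _ hk => Nat.setGcd_dvd_of_mem (s := (R : Set ℕ)) hk
  obtain ⟨N, hN⟩ := Nat.exists_mem_closure_of_ge (R : Set ℕ)
  have hret : ∀ k ≥ N, stepDist P k z z ≠ 0 := fun k hk => by
    have := hN k hk (by simp [hg])
    rwa [AddSubmonoid.closure_eq] at this
  choose κ hκ using fun y => hirr y z
  obtain ⟨M, hM⟩ := (hF.image κ).bddAbove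
  -- `M` steps suffice to reach `z` from anywhere in `F`, and the remaining time is at least `N`, so
  -- it is a possible return time. The extra 1 ensures `1 ≤ m`.
  refine ⟨M + N + 1, by omega, fun y hy => ?_⟩
  have hle : κ y ≤ M := hM ⟨y, hy, rfl⟩
  have := stepDist_add_ne_zero (hκ y) (hret (M + N + 1 - κ y) (by omega))
  rwa [Nat.add_sub_cancel' (by omega)] at this

/-! ### Avoiding a state -/

theorem avoidProb_le_one (P : A → PMF A) (z : A) (k : ℕ) (y : A) : avoidProb P z k y ≤ 1 := by
  induction k generalizing y with
  | zero => simp [avoidProb]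
  | succ k ih =>
    rw [avoidProb, ← (P y).tsum_coe]
    refine ENNReal.tsum_le_tsum fun w => ?_
    split_ifs
    · simp
    · exact mul_le_of_le_one_right' (ih w)

theorem avoidProb_antitone (P : A → PMF A) (z y : A) : Antitone fun k => avoidProb P z k y := by
  refine antitone_nat_of_succ_le fun k => ?_
  induction k generalizing y with
  | zero => exact avoidProb_le_one P z 1 y
  | succ k ih =>
    rw [avoidProb]
    conv_rhs => rw [avoidProb]
    refine ENNReal.tsum_le_tsum fun w => ?_
    split_ifs
    · exact le_rfl
    · exact mul_le_mul_right (ih w) _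

/-- If the probability of avoiding `z` for `k` steps is bounded by `f`, the probability of avoiding
`z` for `m + k` steps is bounded by the expectation of `f` after `m` steps. -/
theorem avoidProb_add_le (P : A → PMF A) (z : A) (k : ℕ) {f : A → ENNReal}
    (hf : ∀ y, avoidProb P z k y ≤ f y) (m : ℕ) (y : A) :
    avoidProb P z (m + 1 + k) y + stepDist P (m + 1) y z * f z ≤ stepExp P (m + 1) f y := by
  classical
  induction m generalizing y with
  | zero =>
    rw [show 0 + 1 + k = k + 1 by ring, avoidProb, zero_add, stepExp, stepDist_one]
    rw [ENNReal.tsum_eq_add_tsum_ite (f := fun w => P y w * f w) z, add_comm]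
    gcongr with w
    split_ifs
    · exact le_rfl
    · exact mul_le_mul_right (hf w) _
  | succ m ih =>
    rw [show m + 1 + 1 + k = (m + 1 + k) + 1 by ring, avoidProb, stepExp_succ, stepDist,
      PMF.bind_apply, ← ENNReal.tsum_mul_right, ← ENNReal.tsum_add]
    refine ENNReal.tsum_le_tsum fun w => ?_
    calc _ ≤ P y w * avoidProb P z (m + 1 + k) w + P y w * stepDist P (m + 1) w z * f z := by
          gcongr
          split_ifs
          · exact zero_le
          · exact le_rfl
      _ = P y w * (avoidProb P z (m + 1 + k) w + stepDist P (m + 1) w z * f z) := by ring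
      _ ≤ _ := mul_le_mul_right (ih w) _

/-- One round of the contraction argument, as an inequality between real numbers. -/
theorem exists_contraction_constants {γ K α R : ℝ} (hγ0 : 0 ≤ γ) (hγ : γ < 1) (hK : 0 ≤ K)
    (hα : 0 < α) (hα1 : α ≤ 1) (hR : 2 * (K + 1) ≤ (1 - γ) * R) :
    ∃ β ρ : ℝ, 0 < β ∧ β ≤ 1 ∧ 0 ≤ ρ ∧ ρ < 1 ∧ ∀ v p : ℝ, 0 ≤ v → 0 ≤ p →
      (v ≤ R → α ≤ p) → β * (γ * v + K) + 1 ≤ ρ * (β * v + 1) + p := by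
  have hR0 : 0 < R := by
    by_contra h
    nlinarith
  set β : ℝ := α / (2 * (R + K + 1)) with hβ
  have hβ0 : 0 < β := by positivity
  have hβe : β * (2 * (R + K + 1)) = α := by rw [hβ]; field_simp
  have hβ1 : β ≤ 1 := by nlinarith
  -- For `v ≤ R` the gain `α` pays for `β (γ v + K) ≤ α / 2`, which needs `ρ ≥ 1 - α / 2`. For `v >
  -- R` half of the drift gives the factor `(1 + γ) / 2` on `β v`, and the other half also covers
  -- the loss `β` in the constant term.
  refine ⟨β, max (1 - β) (max ((1 + γ) / 2) (1 - α / 2)), hβ0, hβ1, ?_, ?_, ?_⟩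
  · exact le_max_of_le_left (by linarith)
  · refine max_lt (by linarith) (max_lt (by linarith) (by linarith))
  · intro v p hv hp h
    set ρ := max (1 - β) (max ((1 + γ) / 2) (1 - α / 2))
    have h1 : 1 - β ≤ ρ := le_max_left _ _
    have h2 : (1 + γ) / 2 ≤ ρ := (le_max_left _ _).trans (le_max_right _ _)
    have h3 : 1 - α / 2 ≤ ρ := (le_max_right _ _).trans (le_max_right _ _)
    have hβv : 0 ≤ β * v := by positivity
    have h4 : (1 + γ) / 2 * (β * v) ≤ ρ * (β * v) := mul_le_mul_of_nonneg_right h2 hβv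
    rcases le_or_gt v R with hvR | hvR
    · have := h hvR
      have h5 : β * (γ * v + K) ≤ β * (R + K + 1) := by
        apply mul_le_mul_of_nonneg_left _ hβ0.le
        nlinarith
      nlinarith
    · have h6 : 2 * (K + 1) ≤ (1 - γ) * v := by nlinarith
      have h7 : β * (2 * (K + 1)) ≤ β * ((1 - γ) * v) := mul_le_mul_of_nonneg_left h6 hβ0.le
      nlinarith

theorem exists_drift_fixedPoint {γ : NNReal} (hγ : γ < 1) (K : NNReal) : ∃ K' : NNReal, γ * K' + K = K' := by
  have hγ1 : (0 : ℝ) < 1 - γ := by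
    have : (γ : ℝ) < 1 := by exact_mod_cast hγ
    linarith
  refine ⟨(K / (1 - γ) : ℝ).toNNReal, ?_⟩
  ext
  push_cast
  rw [Real.coe_toNNReal _ (by positivity)]
  field_simp
  ring

/-- Under a geometric drift towards finite sets from which `z` can be reached in a common number of
steps, the probability of avoiding `z` decays geometrically. -/
theorem exists_avoidProb_le (P : A → PMF A) (z : A) (V : A → NNReal) {γ K : NNReal} (hγ : γ < 1)
    (hV : ∀ x, ∑' y, P x y * (V y : ENNReal) ≤ γ * V x + K)
    (hfin : ∀ R : NNReal, {x | V x ≤ R}.Finite)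
    (hpos : ∀ F : Set A, F.Finite → ∃ m, 1 ≤ m ∧ ∀ y ∈ F, stepDist P m y z ≠ 0) :
    ∃ m : ℕ, 1 ≤ m ∧ ∃ ρ : NNReal, ρ < 1 ∧
      ∀ j y, avoidProb P z (j * m) y ≤ (ρ : ENNReal) ^ j * (V y + 1) := by
  have hγ1 : (0 : ℝ) < 1 - γ := by
    have : (γ : ℝ) < 1 := by exact_mod_cast hγ
    linarith
  obtain ⟨K', hK'⟩ := exists_drift_fixedPoint hγ K
  obtain ⟨R, hR⟩ : ∃ R : NNReal, 2 * ((K' : ℝ) + 1) ≤ (1 - γ) * R := by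
    refine ⟨(2 * ((K' : ℝ) + 1) / (1 - γ)).toNNReal, ?_⟩
    rw [Real.coe_toNNReal _ (by positivity), mul_div_cancel₀ _ hγ1.ne']
  obtain ⟨m, hm1, hm⟩ := hpos _ (hfin R)
  -- A minorization: `α` is the least probability of being in `z` after `m` steps, over the finite
  -- sublevel set. If that set is empty, 1 does.
  obtain ⟨α, hα0, hα1, hα⟩ : ∃ α : ℝ, 0 < α ∧ α ≤ 1 ∧ ∀ y, V y ≤ R →
      α ≤ (stepDist P m y z).toReal := by
    rcases (hfin R).toFinset.eq_empty_or_nonempty with he | hne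
    · refine ⟨1, one_pos, le_rfl, fun y hy => ?_⟩
      have : y ∈ (hfin R).toFinset := by simpa using hy
      simp [he] at this
    · obtain ⟨y₀, hy₀, hmin⟩ := (hfin R).toFinset.exists_min_image
        (fun y => (stepDist P m y z).toReal) hne
      refine ⟨(stepDist P m y₀ z).toReal, ?_, ?_, fun y hy => hmin y (by simpa using hy)⟩
      · exact ENNReal.toReal_pos (hm _ (by simpa using hy₀)) (PMF.apply_ne_top _ _)
      · exact ENNReal.toReal_le_of_le_ofReal zero_le_one (by simpa using PMF.coe_le_one _ _)
  obtain ⟨β, ρ, hβ0, hβ1, hρ0, hρ1, hcon⟩ := exists_contraction_constants (γ := γ) (K := K')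
    γ.coe_nonneg (by exact_mod_cast hγ) K'.coe_nonneg hα0 hα1 hR
  lift β to NNReal using hβ0.le
  lift ρ to NNReal using hρ0
  have hmain : ∀ j y, avoidProb P z (j * m) y ≤ (ρ : ENNReal) ^ j * (β * V y + 1) := by
    intro j
    induction j with
    | zero => intro y; simp [avoidProb]
    | succ j ih =>
      intro y
      obtain ⟨m, rfl⟩ : ∃ m', m = m' + 1 := ⟨m - 1, by omega⟩
      have h1 := avoidProb_add_le P z (j * (m + 1)) ih m y
      have hVm : stepExp P (m + 1) (fun y => (V y : ENNReal)) y ≤ γ * V y + K' := by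
        refine (stepExp_le_of_drift P (K' := K') (by exact_mod_cast hK'.le) hV (m + 1) y).trans ?_
        gcongr
        exact_mod_cast pow_le_of_le_one zero_le hγ.le (by simp)
      have h2 : stepExp P (m + 1) (fun y => (ρ : ENNReal) ^ j * (β * V y + 1)) y ≤
          (ρ : ENNReal) ^ j * (β * (γ * V y + K') + 1) := by
        have : (fun y => (ρ : ENNReal) ^ j * (β * V y + 1)) =
            fun y => (ρ : ENNReal) ^ j * β * V y + (ρ : ENNReal) ^ j := by
          funext y; ring
        rw [this, stepExp_const_mul_add]
        calc _ ≤ (ρ : ENNReal) ^ j * β * (γ * V y + K') + (ρ : ENNReal) ^ j := by gcongr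
          _ = _ := by ring
      have h3 : (β * (γ * V y + K') + 1 : ENNReal) ≤
          ρ * (β * V y + 1) + stepDist P (m + 1) y z := by
        have := hcon (V y) (stepDist P (m + 1) y z).toReal (V y).coe_nonneg ENNReal.toReal_nonneg
          (fun h => hα y (by exact_mod_cast h))
        rw [← ENNReal.coe_toNNReal (PMF.apply_ne_top (stepDist P (m + 1) y) z)]
        exact_mod_cast this
      -- The mass that sits in `z` after the round is kept on both sides, which avoids truncated
      -- subtraction. It is finite and is cancelled at the end.
      have h4 : avoidProb P z (m + 1 + j * (m + 1)) y + (ρ : ENNReal) ^ j * stepDist P (m + 1) y z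
          ≤ (ρ : ENNReal) ^ (j + 1) * (β * V y + 1) + (ρ : ENNReal) ^ j * stepDist P (m + 1) y z := by
        calc _ ≤ avoidProb P z (m + 1 + j * (m + 1)) y +
              stepDist P (m + 1) y z * ((ρ : ENNReal) ^ j * (β * V z + 1)) := by
              rw [mul_comm (stepDist P (m + 1) y z), mul_assoc]
              gcongr
              exact le_mul_of_one_le_left zero_le le_add_self
          _ ≤ (ρ : ENNReal) ^ j * (ρ * (β * V y + 1) + stepDist P (m + 1) y z) :=
              (h1.trans h2).trans (mul_le_mul_right h3 _)
          _ = _ := by ring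
      rw [show (j + 1) * (m + 1) = m + 1 + j * (m + 1) by ring]
      refine ENNReal.le_of_add_le_add_right ?_ h4
      exact ENNReal.mul_ne_top (by simp) (PMF.apply_ne_top _ _)
  refine ⟨m, hm1, ρ, by exact_mod_cast hρ1, fun j y => (hmain j y).trans ?_⟩
  gcongr
  exact mul_le_of_le_one_left' (by exact_mod_cast hβ1)

/-- Monotonicity in the number of steps extends the decay from multiples of `m` to all `k`. The
resulting rate repeats each power of `ρ` exactly `m` times, hence is still summable. -/
theorem exists_avoidProb_rate (P : A → PMF A) (z : A) (V : A → NNReal) {γ K : NNReal} (hγ : γ < 1)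
    (hV : ∀ x, ∑' y, P x y * (V y : ENNReal) ≤ γ * V x + K)
    (hfin : ∀ R : NNReal, {x | V x ≤ R}.Finite)
    (hpos : ∀ F : Set A, F.Finite → ∃ m, 1 ≤ m ∧ ∀ y ∈ F, stepDist P m y z ≠ 0) :
    ∃ r : ℕ → NNReal, Summable r ∧ ∀ k y, avoidProb P z k y ≤ r k * (V y + 1) := by
  obtain ⟨m, hm, ρ, hρ, h⟩ := exists_avoidProb_le P z V hγ hV hfin hpos
  refine ⟨fun k => ρ ^ (k / m), ?_, fun k y => ?_⟩
  · have : NeZero m := ⟨by omega⟩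
    rw [← (Nat.divModEquiv m).symm.summable_iff]
    have hs : Summable fun p : ℕ × Fin m => ρ ^ p.1 * (1 : NNReal) := by
      rw [← NNReal.summable_coe]
      push_cast
      refine Summable.mul_of_nonneg (f := fun j : ℕ => (ρ : ℝ) ^ j) (g := fun _ : Fin m => (1 : ℝ))
        (summable_geometric_of_lt_one ρ.coe_nonneg (by exact_mod_cast hρ)) ?_
        (fun _ => by positivity) (fun _ => by positivity)
      exact (hasSum_fintype _).summable
    refine hs.congr fun p => ?_
    have : (p.1 * m + (p.2 : ℕ)) / m = p.1 := by
      rw [mul_comm, Nat.mul_add_div (by omega), Nat.div_eq_of_lt p.2.2, add_zero]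
    simp [Nat.divModEquiv, this]
  · refine (avoidProb_antitone P z y (Nat.div_mul_le_self k m)).trans ((h (k / m) y).trans ?_)
    simp

theorem meanReturnTime_lt_top (P : A → PMF A) (z : A) (V : A → NNReal) {r : ℕ → NNReal}
    (hr : Summable r) (h : ∀ k y, avoidProb P z k y ≤ r k * (V y + 1)) :
    meanReturnTime P z < ⊤ := by
  calc meanReturnTime P z ≤ ∑' k, (r k : ENNReal) * (V z + 1) := ENNReal.tsum_le_tsum fun k => h k z
    _ = (∑' k, (r k : ENNReal)) * (V z + 1) := ENNReal.tsum_mul_right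
    _ < ⊤ := ENNReal.mul_lt_top (ENNReal.tsum_coe_ne_top_iff_summable.2 hr).lt_top (by finiteness)

end Chain

/-! ### Convergence to the stationary distribution -/

section Coupling

variable {A : Type v}

/-- Two independent copies of the chain. -/
def prodKer (P : A → PMF A) (p : A × A) : PMF (A × A) :=
  (P p.1).bind fun w => (P p.2).map (Prod.mk w)

theorem prodKer_apply (P : A → PMF A) (p w : A × A) :
    prodKer P p w = P p.1 w.1 * P p.2 w.2 := by
  classical
  obtain ⟨w₁, w₂⟩ := w
  simp only [prodKer, PMF.bind_apply, PMF.map_apply, Prod.mk.injEq]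
  rw [tsum_eq_single w₁, tsum_eq_single w₂]
  · simp
  · intro y hy
    simp [hy.symm]
  · intro y hy
    simp [hy.symm]

theorem tsum_prodKer_mul_fst (P : A → PMF A) (p : A × A) (f : A → ENNReal) :
    ∑' w, prodKer P p w * f w.1 = ∑' w, P p.1 w * f w := by
  simp only [prodKer_apply, ENNReal.tsum_prod']
  refine tsum_congr fun w => ?_
  simp only [mul_right_comm _ _ (f w)]
  rw [ENNReal.tsum_mul_left, PMF.tsum_coe, mul_one]

theorem tsum_prodKer_mul_snd (P : A → PMF A) (p : A × A) (f : A → ENNReal) :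
    ∑' w, prodKer P p w * f w.2 = ∑' w, P p.2 w * f w := by
  simp only [prodKer_apply, ENNReal.tsum_prod', mul_assoc, ENNReal.tsum_mul_left]
  rw [ENNReal.tsum_mul_right, PMF.tsum_coe, one_mul]

theorem stepDist_prodKer (P : A → PMF A) (k : ℕ) (p w : A × A) :
    stepDist (prodKer P) k p w = stepDist P k p.1 w.1 * stepDist P k p.2 w.2 := by
  classical
  induction k generalizing p with
  | zero =>
    simp only [stepDist, PMF.pure_apply, Prod.ext_iff]
    split_ifs <;> simp_all
  | succ k ih =>
    simp only [stepDist, PMF.bind_apply, ih, prodKer_apply]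
    rw [ENNReal.tsum_prod', ← ENNReal.tsum_mul_right]
    refine tsum_congr fun u => ?_
    rw [← ENNReal.tsum_mul_left]
    exact tsum_congr fun u' => by ring

/-- The two copies can be distinguished only as long as they have not met in `(z, z)`. -/
theorem stepExp_le_add_avoidProb (P : A → PMF A) (z : A) {f : A → ENNReal} (hf : ∀ y, f y ≤ 1)
    (k : ℕ) (x y : A) :
    stepExp P k f x ≤ stepExp P k f y + avoidProb (prodKer P) (z, z) k (x, y) := by
  induction k generalizing x y with
  | zero =>
    simp only [stepExp_zero, avoidProb]
    exact (hf x).trans le_add_self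
  | succ k ih =>
    rw [stepExp_succ, stepExp_succ, avoidProb, ← tsum_prodKer_mul_fst P (x, y),
      ← tsum_prodKer_mul_snd P (x, y), ← ENNReal.tsum_add]
    refine ENNReal.tsum_le_tsum fun p => ?_
    split_ifs with h
    -- At the meeting point both copies are in `z`, so their future expectations are equal and no
    -- error is incurred.
    · simp [h]
    · rw [← mul_add]
      exact mul_le_mul_right (ih p.1 p.2) _

/-- Fatou's lemma for the counting measure. -/
theorem tsum_le_liminf_tsum {f : ℕ → A → ENNReal} {l : A → ENNReal}
    (h : ∀ a, Tendsto (fun k => f k a) atTop (𝓝 (l a))) :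
    ∑' a, l a ≤ liminf (fun k => ∑' a, f k a) atTop := by
  let _ : MeasurableSpace A := ⊤
  simp only [← lintegral_count]
  calc ∫⁻ a, l a ∂Measure.count = ∫⁻ a, liminf (fun k => f k a) atTop ∂Measure.count :=
        lintegral_congr fun a => (h a).liminf_eq.symm
    _ ≤ _ := lintegral_liminf_le fun k => measurable_from_top

variable {P : A → PMF A} {V : A → NNReal} {γ K : NNReal}

theorem tsum_prodKer_le_of_drift (hV : ∀ x, ∑' y, P x y * (V y : ENNReal) ≤ γ * V x + K)
    (p : A × A) : ∑' w, prodKer P p w * ((V w.1 + V w.2 : NNReal) : ENNReal) ≤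
      γ * (V p.1 + V p.2 : NNReal) + (2 * K : NNReal) := by
  simp only [ENNReal.coe_add, ENNReal.coe_mul, mul_add]
  rw [ENNReal.tsum_add, tsum_prodKer_mul_fst P p fun w => (V w : ENNReal),
    tsum_prodKer_mul_snd P p fun w => (V w : ENNReal)]
  calc _ ≤ (γ * V p.1 + K : ENNReal) + (γ * V p.2 + K) := add_le_add (hV _) (hV _)
    _ = _ := by push_cast; ring

theorem finite_prod_sublevel (hfin : ∀ R : NNReal, {x | V x ≤ R}.Finite) (R : NNReal) :
    {p : A × A | V p.1 + V p.2 ≤ R}.Finite := by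
  refine ((hfin R).prod (hfin R)).subset fun p (hp : V p.1 + V p.2 ≤ R) => Set.mem_prod.2 ⟨?_, ?_⟩
  · exact le_self_add.trans hp
  · exact le_add_self.trans hp

/-- Irreducibility alone would not pass to the product. Aperiodicity supplies one number of steps
that works for all first and second coordinates simultaneously. -/
theorem exists_stepDist_prodKer_ne_zero (hirr : Irreducible P) (hap : Aperiodic P) (z : A)
    {F : Set (A × A)} (hF : F.Finite) :
    ∃ m, 1 ≤ m ∧ ∀ y ∈ F, stepDist (prodKer P) m y (z, z) ≠ 0 := by
  obtain ⟨m, hm, h⟩ := exists_stepDist_ne_zero hirr hap z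
    ((hF.image Prod.fst).union (hF.image Prod.snd))
  refine ⟨m, hm, fun p hp => ?_⟩
  rw [stepDist_prodKer]
  exact mul_ne_zero (h _ (.inl ⟨p, hp, rfl⟩)) (h _ (.inr ⟨p, hp, rfl⟩))

theorem exists_coupling_rate (hirr : Irreducible P) (hap : Aperiodic P) (z : A) (hγ : γ < 1)
    (hV : ∀ x, ∑' y, P x y * (V y : ENNReal) ≤ γ * V x + K)
    (hfin : ∀ R : NNReal, {x | V x ≤ R}.Finite) :
    ∃ r : ℕ → NNReal, Tendsto r atTop (𝓝 0) ∧ ∀ f : A → ENNReal, (∀ y, f y ≤ 1) → ∀ k x y,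
      stepExp P k f x ≤ stepExp P k f y + r k * (V x + V y + 1) := by
  obtain ⟨r, hr, h⟩ := exists_avoidProb_rate (prodKer P) (z, z) (fun p => V p.1 + V p.2) hγ
    (tsum_prodKer_le_of_drift hV) (finite_prod_sublevel hfin)
    (fun F hF => exists_stepDist_prodKer_ne_zero hirr hap z hF)
  refine ⟨r, NNReal.tendsto_atTop_zero_of_summable hr, fun f hf k x y => ?_⟩
  refine (stepExp_le_add_avoidProb P z hf k x y).trans ?_
  refine add_le_add_right ((h k (x, y)).trans_eq ?_) _
  push_cast
  rfl

theorem positiveRecurrent_of_drift (hirr : Irreducible P) (hap : Aperiodic P) (hγ : γ < 1)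
    (hV : ∀ x, ∑' y, P x y * (V y : ENNReal) ≤ γ * V x + K)
    (hfin : ∀ R : NNReal, {x | V x ≤ R}.Finite) : PositiveRecurrent P := by
  intro z
  obtain ⟨r, hr, h⟩ := exists_avoidProb_rate P z V hγ hV hfin
    fun F hF => exists_stepDist_ne_zero hirr hap z hF
  exact meanReturnTime_lt_top P z V hr h

/-- Running `l + k` steps amounts to running `k` steps from a random state whose expected `V` is
bounded uniformly in `l`. The coupling bound, averaged over that state, makes the sequence Cauchy;
applied to two fixed starting points it makes the limit independent of the start. -/
theorem exists_tendsto_stepDist (hirr : Irreducible P) (hap : Aperiodic P) (hγ : γ < 1)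
    (hV : ∀ x, ∑' y, P x y * (V y : ENNReal) ≤ γ * V x + K)
    (hfin : ∀ R : NNReal, {x | V x ≤ R}.Finite) (z : A) :
    ∃ L : A → ENNReal, ∀ x y, Tendsto (fun k => stepDist P k x y) atTop (𝓝 (L y)) := by
  classical
  obtain ⟨r, hr, hc⟩ := exists_coupling_rate hirr hap z hγ hV hfin
  obtain ⟨K', hK'⟩ := exists_drift_fixedPoint hγ K
  have hVk : ∀ k x, stepExp P k (fun y => (V y : ENNReal)) x ≤ V x + K' := fun k x => by
    refine (stepExp_le_of_drift P (K' := K') (by exact_mod_cast hK'.le) hV k x).trans ?_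
    gcongr
    exact mul_le_of_le_one_left' (pow_le_one₀ zero_le (by exact_mod_cast hγ.le))
  have hsingle : ∀ k x y, stepExp P k (Pi.single y 1) x = stepDist P k x y := by
    intro k x y
    rw [stepExp, tsum_eq_single y]
    · simp
    · intro w hw
      simp [hw]
  have hcmp : ∀ k x x' y, stepDist P k x y ≤ stepDist P k x' y + r k * (V x + V x' + 1) := by
    intro k x x' y
    rw [← hsingle, ← hsingle]
    refine hc _ (fun w => ?_) k x x'
    by_cases hw : w = y
    · subst hw; simp
    · simp [hw]
  have hr' : Tendsto (fun k => (r k : ENNReal)) atTop (𝓝 0) := by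
    rw [← ENNReal.coe_zero]
    exact ENNReal.tendsto_coe.2 hr
  have havg : ∀ k l x y, stepDist P (l + k) x y = stepExp P l (fun w => stepDist P k w y) x := by
    intro k l x y
    rw [stepDist_add, PMF.bind_apply, stepExp]
  have hup : ∀ k l x y, stepDist P (l + k) x y ≤
      stepDist P k x y + r k * (V x + (V x + K' : NNReal) + 1) := by
    intro k l x y
    rw [havg]
    calc _ ≤ stepExp P l (fun w => r k * V w + (stepDist P k x y + r k * (V x + 1))) x :=
          stepExp_mono P l (fun w => (hcmp k w x y).trans (by ring_nf; exact le_rfl)) x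
      _ = r k * stepExp P l (fun w => (V w : ENNReal)) x +
          (stepDist P k x y + r k * (V x + 1)) := stepExp_const_mul_add ..
      _ ≤ r k * (V x + K') + (stepDist P k x y + r k * (V x + 1)) := by gcongr; exact hVk l x
      _ = _ := by push_cast; ring
  have hdown : ∀ k l x y, stepDist P k x y ≤
      stepDist P (l + k) x y + r k * (V x + (V x + K' : NNReal) + 1) := by
    intro k l x y
    rw [havg]
    have h0 : stepExp P l (fun w => 0 * stepDist P k w y + stepDist P k x y) x =
        stepDist P k x y := by rw [stepExp_const_mul_add]; simp
    have h1 : stepExp P l (fun w => stepDist P k w y + (r k * V w + r k * (V x + 1))) x =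
        stepExp P l (fun w => stepDist P k w y) x +
          (r k * stepExp P l (fun w => (V w : ENNReal)) x + r k * (V x + 1)) := by
      rw [← stepExp_const_mul_add]
      simp only [stepExp, mul_add]
      rw [ENNReal.tsum_add]
    calc _ = _ := h0.symm
      _ ≤ stepExp P l (fun w => stepDist P k w y + (r k * V w + r k * (V x + 1))) x :=
          stepExp_mono P l (fun w => by
            rw [zero_mul, zero_add]
            exact (hcmp k x w y).trans (by ring_nf; exact le_rfl)) x
      _ = _ := h1
      _ ≤ stepExp P l (fun w => stepDist P k w y) x + (r k * (V x + K') + r k * (V x + 1)) := by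
          gcongr; exact hVk l x
      _ = _ := by push_cast; ring
  have hex : ∀ x y, ∃ L : ENNReal, Tendsto (fun k => stepDist P k x y) atTop (𝓝 L) := by
    intro x y
    have hreal : ∀ a b : ENNReal, ∀ c : NNReal, a ≠ ⊤ → b ≠ ⊤ → a ≤ b + c → b ≤ a + c →
        dist a.toReal b.toReal ≤ c := by
      intro a b c ha hb h1 h2
      lift a to NNReal using ha
      lift b to NNReal using hb
      have h1' : (a : ℝ) ≤ b + c := by exact_mod_cast h1
      have h2' : (b : ℝ) ≤ a + c := by exact_mod_cast h2
      rw [Real.dist_eq, abs_le]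
      simp only [ENNReal.coe_toReal]
      constructor <;> linarith
    have hcau : CauchySeq fun k => (stepDist P k x y).toReal := by
      refine cauchySeq_of_le_tendsto_0' (fun k => ((r k * (V x + (V x + K') + 1) : NNReal) : ℝ))
        (fun k m hkm => ?_) ?_
      · obtain ⟨l, rfl⟩ := Nat.exists_eq_add_of_le' hkm
        refine hreal _ _ _ (PMF.apply_ne_top _ _) (PMF.apply_ne_top _ _) ?_ ?_
        · exact_mod_cast hdown k l x y
        · exact_mod_cast hup k l x y
      · have := hr.mul_const (V x + (V x + K') + 1)
        rw [zero_mul] at this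
        rw [← NNReal.coe_zero]
        exact NNReal.tendsto_coe.2 this
    obtain ⟨L, hL⟩ := cauchySeq_tendsto_of_complete hcau
    refine ⟨ENNReal.ofReal L, ?_⟩
    refine (ENNReal.tendsto_ofReal hL).congr fun k => ?_
    exact ENNReal.ofReal_toReal (PMF.apply_ne_top _ _)
  choose L hL using hex
  have hle : ∀ x x' y, L x y ≤ L x' y := by
    intro x x' y
    refine le_of_tendsto_of_tendsto' (hL x y)
      (g := fun k => stepDist P k x' y + r k * (V x + V x' + 1)) ?_ fun k => hcmp k x x' y
    have := (hL x' y).add (ENNReal.Tendsto.mul_const hr' (b := (V x + V x' + 1 : ENNReal))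
      (.inr (by finiteness)))
    simpa using this
  refine ⟨L z, fun x y => ?_⟩
  rw [(hle z x y).antisymm (hle x z y)]
  exact hL x y

/-- The bounded expectation of `V` gives tightness, so no mass escapes in the pointwise limit.
Invariance then follows by comparing total masses. -/
theorem exists_stationary [Nonempty A] (hirr : Irreducible P) (hap : Aperiodic P) (hγ : γ < 1)
    (hV : ∀ x, ∑' y, P x y * (V y : ENNReal) ≤ γ * V x + K)
    (hfin : ∀ R : NNReal, {x | V x ≤ R}.Finite) :
    ∃ π : PMF A, (∀ x y, Tendsto (fun k => stepDist P k x y) atTop (𝓝 (π y))) ∧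
      π.bind P = π := by
  classical
  obtain ⟨z⟩ := ‹Nonempty A›
  obtain ⟨L, hL⟩ := exists_tendsto_stepDist hirr hap hγ hV hfin z
  obtain ⟨K', hK'⟩ := exists_drift_fixedPoint hγ K
  have hVk : ∀ k x, stepExp P k (fun y => (V y : ENNReal)) x ≤ V x + K' := fun k x => by
    refine (stepExp_le_of_drift P (K' := K') (by exact_mod_cast hK'.le) hV k x).trans ?_
    gcongr
    exact mul_le_of_le_one_left' (pow_le_one₀ zero_le (by exact_mod_cast hγ.le))
  have hle1 : ∑' y, L y ≤ 1 := by
    refine (tsum_le_liminf_tsum (hL z)).trans ?_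
    simp
  -- Markov's inequality: the mass outside the finite set `V ≤ N` is at most `(V z + K') / N`,
  -- uniformly in `k`.
  have hge : ∀ N : ℕ, 1 ≤ ∑' y, L y + (V z + K') * ((N : ENNReal))⁻¹ := by
    intro N
    let F := (hfin N).toFinset
    have hk : ∀ k, 1 ≤ ∑ y ∈ F, stepDist P k z y + (V z + K') * ((N : ENNReal))⁻¹ := by
      intro k
      calc (1 : ENNReal) = ∑' y, stepDist P k z y := (PMF.tsum_coe _).symm
        _ ≤ ∑' y, ((if y ∈ F then stepDist P k z y else 0) +
            stepDist P k z y * V y * ((N : ENNReal))⁻¹) := by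
          refine ENNReal.tsum_le_tsum fun y => ?_
          split_ifs with hy
          · exact le_self_add
          · have hVy : (N : ENNReal) ≤ V y := by
              have : ¬ V y ≤ N := by simpa [F] using hy
              exact_mod_cast (not_le.1 this).le
            rw [zero_add, mul_assoc]
            refine le_mul_of_one_le_right' ?_
            rcases eq_or_ne N 0 with rfl | hN
            · have : V y ≠ 0 := fun h0 => by simp [F, h0] at hy
              simp [ENNReal.mul_top, this]
            · rw [← ENNReal.mul_inv_cancel (a := (N : ENNReal)) (by simpa using hN) (by simp)]
              gcongr
        _ = ∑ y ∈ F, stepDist P k z y +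
            stepExp P k (fun y => (V y : ENNReal)) z * ((N : ENNReal))⁻¹ := by
          rw [ENNReal.tsum_add, ENNReal.tsum_mul_right, stepExp]
          congr 1
          rw [tsum_eq_sum (s := F) (fun y hy => by simp [hy])]
          exact Finset.sum_congr rfl fun y hy => by simp [hy]
        _ ≤ _ := by gcongr; exact hVk k z
    have hlim : Tendsto (fun k => ∑ y ∈ F, stepDist P k z y + (V z + K') * ((N : ENNReal))⁻¹) atTop
        (𝓝 (∑ y ∈ F, L y + (V z + K') * ((N : ENNReal))⁻¹)) :=
      (tendsto_finsetSum F fun y _ => hL z y).add tendsto_const_nhds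
    refine (ge_of_tendsto' hlim hk).trans ?_
    gcongr
    exact ENNReal.sum_le_tsum F
  have hsum : ∑' y, L y = 1 := by
    refine le_antisymm hle1 ?_
    refine ge_of_tendsto' (b := 1) (x := atTop) ?_ hge
    have := (ENNReal.Tendsto.const_mul ENNReal.tendsto_inv_nat_nhds_zero
      (a := (V z + K' : ENNReal)) (.inr (by finiteness))).const_add (∑' y, L y)
    simpa using this
  refine ⟨⟨L, hsum ▸ ENNReal.summable.hasSum⟩, hL, ?_⟩
  set π : PMF A := ⟨L, hsum ▸ ENNReal.summable.hasSum⟩ with hπ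
  have hπL : ∀ y, π y = L y := fun y => rfl
  -- Fatou gives only this inequality. Both sides have total mass 1, so it cannot be strict
  -- anywhere.
  have hsub : ∀ y, π.bind P y ≤ π y := by
    intro y
    rw [PMF.bind_apply]
    have := tsum_le_liminf_tsum (f := fun k w => stepDist P k z w * P w y) (l := fun w => π w * P w y)
      fun w => ENNReal.Tendsto.mul_const (hL z w) (.inr (PMF.apply_ne_top _ _))
    refine this.trans (le_of_eq ?_)
    simp only [← PMF.bind_apply, ← stepDist_succ_right]
    exact ((hL z y).comp (tendsto_add_atTop_nat 1)).liminf_eq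
  ext y
  by_contra hne
  have hlt := lt_of_le_of_ne (hsub y) hne
  have := ENNReal.tsum_lt_tsum (PMF.tsum_coe_ne_top _) hsub hlt
  rw [PMF.tsum_coe, PMF.tsum_coe] at this
  exact lt_irrefl _ this

/-- Fatou's lemma for the chain started in the distribution `p`. -/
theorem tsum_le_liminf_stepExp {π : PMF A}
    (hπ : ∀ x y, Tendsto (fun k => stepDist P k x y) atTop (𝓝 (π y))) (p : PMF A)
    {f : A → ENNReal} (hf : ∀ y, f y ≠ ⊤) :
    ∑' y, π y * f y ≤ liminf (fun k => ∑' x, p x * stepExp P k f x) atTop := by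
  have := tsum_le_liminf_tsum (A := A × A) (f := fun k w => p w.1 * (stepDist P k w.1 w.2 * f w.2))
    (l := fun w => p w.1 * (π w.2 * f w.2)) fun w =>
      ENNReal.Tendsto.const_mul (ENNReal.Tendsto.mul_const (hπ w.1 w.2) (.inr (hf _)))
        (.inr (PMF.apply_ne_top _ _))
  simpa only [ENNReal.tsum_prod', ENNReal.tsum_mul_left, ENNReal.tsum_mul_right, PMF.tsum_coe,
    one_mul, stepExp] using this

/-- A geometric drift bounds the stationary expectation. -/
theorem tsum_stationary_le_of_drift {π : PMF A}
    (hπ : ∀ x y, Tendsto (fun k => stepDist P k x y) atTop (𝓝 (π y))) {K' : NNReal} (hγ : γ < 1)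
    (hK' : γ * K' + K ≤ K') (hV : ∀ x, ∑' y, P x y * (V y : ENNReal) ≤ γ * V x + K) :
    ∑' y, π y * (V y : ENNReal) ≤ K' := by
  obtain ⟨z, -⟩ := π.support_nonempty
  have h1 : ∑' y, π y * (V y : ENNReal) ≤
      liminf (fun k => stepExp P k (fun y => (V y : ENNReal)) z) atTop :=
    tsum_le_liminf_tsum fun w => ENNReal.Tendsto.mul_const (hπ z w) (.inr (by simp))
  have h2 : Tendsto (fun k : ℕ => (γ : ENNReal) ^ k * V z + K') atTop (𝓝 K') := by
    have := (ENNReal.Tendsto.mul_const (ENNReal.tendsto_pow_atTop_nhds_zero_of_lt_one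
      (r := (γ : ENNReal)) (by exact_mod_cast hγ)) (b := (V z : ENNReal))
      (.inr (by simp))).add_const (K' : ENNReal)
    simpa using this
  refine h1.trans ((liminf_le_liminf (Eventually.of_forall fun k => ?_)).trans h2.liminf_eq.le)
  exact stepExp_le_of_drift P (by exact_mod_cast hK') hV k z

end Coupling

/-! ### A drift inequality for exponentials -/

/-- A random variable close to `w` whose second moment drops linearly in `w` has contracting
exponential moments, with constants that depend only on the bounds. -/
theorem exists_exp_drift {D η C : ℝ} (hη : 0 < η) (hηD : η ≤ D) (hC : 0 ≤ C) :
    ∃ θ : ℝ, 0 < θ ∧ ∃ γ K : NNReal, γ < 1 ∧ ∀ (Ω : Type u) [MeasurableSpace Ω] (m : Measure Ω)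
      [IsProbabilityMeasure m] (Y : Ω → ℝ) (w : ℝ), 0 ≤ w → AEMeasurable Y m →
      (∀ᵐ ω ∂m, |Y ω - w| ≤ D) → ∫ ω, Y ω ^ 2 ∂m ≤ w ^ 2 - 2 * η * w + C →
      ∫ ω, Real.exp (θ * Y ω) ∂m ≤ γ * Real.exp (θ * w) + K := by
  have hD : 0 < D := hη.trans_le hηD
  -- Chosen so that the quadratic Taylor term `θ² D²` is `θ η / 4`, half of the drift `θ η / 2` that
  -- remains for large `w`, while `θ D ≤ 1` keeps the Taylor bound valid.
  set θ : ℝ := η / (4 * D ^ 2) with hθ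
  have hθ0 : 0 < θ := by positivity
  have hθD : θ * D ^ 2 = η / 4 := by rw [hθ]; field_simp
  have hθη : θ * η ≤ 1 := by
    have h2 : η * η ≤ D ^ 2 := by nlinarith
    rw [hθ, div_mul_eq_mul_div, div_le_one (by positivity)]
    nlinarith
  have hθD1 : θ * D ≤ 1 := by
    have : θ * D = η / (4 * D) := by rw [hθ]; field_simp
    rw [this, div_le_one (by positivity)]
    linarith
  have hγ0 : 0 ≤ 1 - θ * η / 4 := by linarith
  refine ⟨θ, hθ0, (1 - θ * η / 4).toNNReal, (Real.exp (θ * (C / η + D))).toNNReal, ?_, ?_⟩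
  · have : 0 < θ * η := by positivity
    rw [← NNReal.coe_lt_coe, Real.coe_toNNReal _ hγ0, NNReal.coe_one]
    linarith
  intro Ω _ m _ Y w hw hY hYw hdrift
  rw [Real.coe_toNNReal _ hγ0, Real.coe_toNNReal _ (Real.exp_pos _).le]
  have hbd : ∀ᵐ ω ∂m, Real.exp (θ * Y ω) ≤ Real.exp (θ * (w + D)) := by
    filter_upwards [hYw] with ω h
    have := (abs_le.1 h).2
    gcongr
    linarith
  have hint : Integrable (fun ω => Real.exp (θ * Y ω)) m := by
    refine Integrable.of_bound (C := Real.exp (θ * (w + D))) ?_ ?_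
    · exact (Real.measurable_exp.comp_aemeasurable (hY.const_mul θ)).aestronglyMeasurable
    · filter_upwards [hbd] with ω h
      rwa [Real.norm_of_nonneg (Real.exp_pos _).le]
  -- Below the threshold the exponential is bounded by the constant; above it, `C` uses up at most
  -- half of the drift `2 η w`.
  rcases le_or_gt w (C / η) with hwC | hwC
  · calc ∫ ω, Real.exp (θ * Y ω) ∂m ≤ ∫ _, Real.exp (θ * (C / η + D)) ∂m := by
          refine integral_mono_ae hint (integrable_const _) ?_
          filter_upwards [hbd] with ω h
          refine h.trans ?_
          gcongr
      _ = Real.exp (θ * (C / η + D)) := by simp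
      _ ≤ _ := le_add_of_nonneg_left (by positivity)
  · have hw0 : 0 < w := lt_of_le_of_lt (by positivity) hwC
    have hY2 : Integrable (fun ω => Y ω ^ 2) m := by
      refine Integrable.of_bound (C := (w + D) ^ 2) (hY.pow_const 2).aestronglyMeasurable ?_
      filter_upwards [hYw] with ω h
      have := abs_le.1 h
      rw [Real.norm_of_nonneg (sq_nonneg _)]
      apply sq_le_sq'
      · linarith
      · linarith
    have hpt : ∀ᵐ ω ∂m, Real.exp (θ * Y ω) ≤
        Real.exp (θ * w) * (1 + θ / (2 * w) * (Y ω ^ 2 - w ^ 2) + θ ^ 2 * D ^ 2) := by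
      filter_upwards [hYw] with ω h
      have hx : |θ * (Y ω - w)| ≤ 1 := by
        rw [abs_mul, abs_of_pos hθ0]
        exact (mul_le_mul_of_nonneg_left h hθ0.le).trans hθD1
      have h1 := (abs_le.1 (Real.abs_exp_sub_one_sub_id_le hx)).2
      have h2 : θ * Y ω = θ * w + θ * (Y ω - w) := by ring
      rw [h2, Real.exp_add]
      refine mul_le_mul_of_nonneg_left ?_ (Real.exp_pos _).le
      have h3 : (θ * (Y ω - w)) ^ 2 ≤ θ ^ 2 * D ^ 2 := by
        rw [mul_pow]
        refine mul_le_mul_of_nonneg_left (sq_le_sq.2 ?_) (sq_nonneg _)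
        rwa [abs_of_pos hD]
      -- From `2w(Y - w) = Y² - w² - (Y - w)²`: this is how a drift of the square controls a drift
      -- of the variable itself.
      have h4 : θ * (Y ω - w) ≤ θ / (2 * w) * (Y ω ^ 2 - w ^ 2) := by
        have : θ * (Y ω - w) = θ / (2 * w) * (2 * w * (Y ω - w)) := by field_simp
        rw [this]
        refine mul_le_mul_of_nonneg_left ?_ (by positivity)
        nlinarith [sq_nonneg (Y ω - w)]
      linarith
    have hI : ∫ ω, Real.exp (θ * w) * (1 + θ / (2 * w) * (Y ω ^ 2 - w ^ 2) + θ ^ 2 * D ^ 2) ∂m =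
        Real.exp (θ * w) *
          (1 + θ / (2 * w) * (∫ ω, Y ω ^ 2 ∂m - w ^ 2) + θ ^ 2 * D ^ 2) := by
      rw [integral_const_mul, integral_add (by fun_prop) (by fun_prop),
        integral_add (by fun_prop) (by fun_prop), integral_const_mul,
        integral_sub hY2 (by fun_prop)]
      simp
    calc ∫ ω, Real.exp (θ * Y ω) ∂m ≤ _ := integral_mono_ae hint (by fun_prop) hpt
      _ = _ := hI
      _ ≤ Real.exp (θ * w) * (1 - θ * η / 4) := by
        refine mul_le_mul_of_nonneg_left ?_ (Real.exp_pos _).le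
        have h5 : θ / (2 * w) * (∫ ω, Y ω ^ 2 ∂m - w ^ 2) ≤ θ / (2 * w) * (- 2 * η * w + η * w) := by
          refine mul_le_mul_of_nonneg_left ?_ (by positivity)
          have : C ≤ η * w := by
            rw [div_lt_iff₀ hη] at hwC
            linarith
          linarith
        have h6 : θ / (2 * w) * (- 2 * η * w + η * w) = - (θ * η / 2) := by
          field_simp
          ring
        have h7 : θ ^ 2 * D ^ 2 = θ * η / 4 := by rw [sq θ, mul_assoc, hθD]; ring
        linarith
      _ ≤ _ := by rw [mul_comm]; exact le_add_of_nonneg_right (Real.exp_pos _).le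

/-! ### The cone and the projection onto the space `𝒮` -/

section Geometry

variable {n : ℕ}

theorem projK_mem (x : Vec n) : projK x ∈ coneK n := (exists_projK x).choose_spec.1

theorem zero_mem_coneK : (0 : Vec n) ∈ coneK n := ⟨(spaceS n).zero_mem, fun p => by simp⟩

theorem norm_perpK_le {x z : Vec n} (hz : z ∈ coneK n) : ‖perpK x‖ ≤ ‖x - z‖ :=
  (exists_projK x).choose_spec.2 z hz

theorem norm_perpK_le_norm (x : Vec n) : ‖perpK x‖ ≤ ‖x‖ := by
  simpa using norm_perpK_le (x := x) zero_mem_coneK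

theorem norm_perpK_le_add (x y : Vec n) : ‖perpK x‖ ≤ ‖perpK y‖ + ‖x - y‖ := by
  calc ‖perpK x‖ ≤ ‖x - projK y‖ := norm_perpK_le (projK_mem y)
    _ = ‖perpK y + (x - y)‖ := by rw [perpK]; congr 1; abel
    _ ≤ _ := norm_add_le _ _

/-- The distance to a set is 1-Lipschitz; only the minimality of the nearest point is used, not
convexity. -/
theorem abs_norm_perpK_sub_le (x y : Vec n) : |‖perpK x‖ - ‖perpK y‖| ≤ ‖x - y‖ := by
  have h₁ := norm_perpK_le_add x y
  have h₂ := norm_perpK_le_add y x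
  rw [norm_sub_rev] at h₂
  rw [abs_le]
  constructor <;> linarith

theorem inner_eq_sum (x y : Vec n) : inner ℝ x y = ∑ i, ∑ j, x (i, j) * y (i, j) := by
  rw [PiLp.inner_apply, Fintype.sum_prod_type]
  exact Finset.sum_congr rfl fun i _ => Finset.sum_congr rfl fun j _ => by
    simp [mul_comm]

@[simp]
theorem vec_apply (M : Fin n → Fin n → ℝ) (i j : Fin n) : vec M (i, j) = M i j := rfl

@[simp]
theorem natVec_apply (M : NMat n) (i j : Fin n) : natVec M (i, j) = M i j := rfl

/-- The sum of all entries. -/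
def total (x : Vec n) : ℝ := ∑ i, ∑ j, x (i, j)

/-- All row sums and all column sums are `1`. -/
def UnitSums (x : Vec n) : Prop := (∀ i, ∑ j, x (i, j) = 1) ∧ ∀ j, ∑ i, x (i, j) = 1

theorem UnitSums.total_eq {x : Vec n} (hx : UnitSums x) : total x = n := by
  simp [total, hx.1]

/-- An element `wᵢ + w'ⱼ` of `𝒮` sees a matrix only through its row and column sums. Hence neither
schedules nor `ν` can be told apart within `𝒮`. -/
theorem inner_eq_of_unitSums {p x y : Vec n} (hp : p ∈ spaceS n) (hx : UnitSums x)
    (hy : UnitSums y) : inner ℝ p x = inner ℝ p y := by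
  obtain ⟨w, w', h⟩ := hp
  have key : ∀ z : Vec n, UnitSums z → inner ℝ p z = ∑ i, w i + ∑ j, w' j := by
    intro z hz
    simp only [inner_eq_sum, h, add_mul, Finset.sum_add_distrib]
    congr 1
    · simp [← Finset.mul_sum, hz.1]
    · rw [Finset.sum_comm]
      simp [← Finset.mul_sum, hz.2]
  rw [key x hx, key y hy]

theorem unitSums_of_isSchedule {s : NMat n} (hs : IsSchedule s) : UnitSums (natVec s) := by
  obtain ⟨τ, h⟩ := hs
  refine ⟨fun i => ?_, fun j => ?_⟩
  · simp [h]
  · simp only [natVec_apply, h]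
    rw [Finset.sum_eq_single (τ.symm j)]
    · simp
    · intro i _ hi
      have : τ i ≠ j := fun h => hi (by simp [← h])
      simp [this]
    · simp

theorem unitSums_of_mem_doublyStochastic {ν : Matrix (Fin n) (Fin n) ℝ}
    (hν : ν ∈ doublyStochastic ℝ (Fin n)) : UnitSums (vec ν) := by
  rw [mem_doublyStochastic_iff_sum] at hν
  exact ⟨hν.2.1, hν.2.2⟩

/-- The orthogonal projection onto `𝒮`. -/
def projS (n : ℕ) : Vec n →ₗ[ℝ] Vec n where
  toFun x := vec fun i j =>
    (∑ k, x (i, k)) / n + (∑ k, x (k, j)) / n - (∑ k, ∑ l, x (k, l)) / (n : ℝ) ^ 2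
  map_add' x y := by
    ext ⟨i, j⟩
    simp only [vec_apply, PiLp.add_apply, Finset.sum_add_distrib]
    ring
  map_smul' c x := by
    ext ⟨i, j⟩
    simp only [vec_apply, PiLp.smul_apply, smul_eq_mul, ← Finset.mul_sum, RingHom.id_apply]
    ring

theorem projS_apply (x : Vec n) (i j : Fin n) : projS n x (i, j) =
    (∑ k, x (i, k)) / n + (∑ k, x (k, j)) / n - (∑ k, ∑ l, x (k, l)) / (n : ℝ) ^ 2 := rfl

theorem inner_projS (x y : Vec n) : inner ℝ (projS n x) y =
    (∑ i, (∑ k, x (i, k)) * ∑ k, y (i, k)) / n + (∑ j, (∑ k, x (k, j)) * ∑ k, y (k, j)) / n -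
      total x * total y / (n : ℝ) ^ 2 := by
  simp only [inner_eq_sum, projS_apply, sub_mul, add_mul, Finset.sum_sub_distrib,
    Finset.sum_add_distrib]
  congr 1
  · congr 1
    · simp only [← Finset.mul_sum]
      rw [Finset.sum_div]
      exact Finset.sum_congr rfl fun i _ => by ring
    · rw [Finset.sum_comm]
      simp only [← Finset.mul_sum]
      rw [Finset.sum_div]
      exact Finset.sum_congr rfl fun i _ => by ring
  · simp only [← Finset.mul_sum, total]
    ring

theorem inner_projS_comm (x y : Vec n) : inner ℝ (projS n x) y = inner ℝ (projS n y) x := by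
  rw [inner_projS, inner_projS, mul_comm (total x)]
  congr 3 <;> exact Finset.sum_congr rfl fun i _ => mul_comm _ _

theorem projS_of_mem (hn : 0 < n) {x : Vec n} (hx : x ∈ spaceS n) : projS n x = x := by
  have hn' : (n : ℝ) ≠ 0 := by positivity
  obtain ⟨w, w', h⟩ := hx
  ext ⟨i, j⟩
  simp only [projS_apply, h, Finset.sum_add_distrib, Finset.sum_const, Finset.card_univ,
    Fintype.card_fin, nsmul_eq_mul, ← Finset.mul_sum]
  field_simp
  ring

theorem projS_of_unitSums (hn : 0 < n) {x : Vec n} (hx : UnitSums x) :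
    projS n x = vec fun _ _ => 1 / (n : ℝ) := by
  have hn' : (n : ℝ) ≠ 0 := by positivity
  ext ⟨i, j⟩
  simp only [projS_apply, hx.1, hx.2, vec_apply, Finset.sum_const, Finset.card_univ,
    Fintype.card_fin, nsmul_eq_mul]
  field_simp
  ring

theorem inner_projS_of_unitSums (hn : 0 < n) {x y : Vec n} (hy : UnitSums y) :
    inner ℝ (projS n x) y = total x / n := by
  rw [inner_projS_comm, projS_of_unitSums hn hy, inner_eq_sum]
  simp only [vec_apply, ← Finset.mul_sum, total]
  ring

theorem exists_norm_projS_le (n : ℕ) : ∃ c : ℝ, ∀ x : Vec n, ‖projS n x‖ ≤ c * ‖x‖ :=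
  ⟨‖(projS n).toContinuousLinearMap‖, (projS n).toContinuousLinearMap.le_opNorm⟩

theorem natVec_nonneg (M : NMat n) (p : Fin n × Fin n) : 0 ≤ natVec M p := Nat.cast_nonneg _

theorem norm_sq_eq_sum (x : Vec n) : ‖x‖ ^ 2 = ∑ i, ∑ j, x (i, j) ^ 2 := by
  rw [← real_inner_self_eq_norm_sq, inner_eq_sum]
  exact Finset.sum_congr rfl fun i _ => Finset.sum_congr rfl fun j _ => by ring

theorem entry_le_norm (x : Vec n) (p : Fin n × Fin n) : x p ≤ ‖x‖ :=
  (le_abs_self _).trans (PiLp.norm_apply_le x p)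

theorem total_natVec_le (M : NMat n) : total (natVec M) ≤ n ^ 2 * ‖natVec M‖ := by
  calc total (natVec M) ≤ ∑ _i : Fin n, ∑ _j : Fin n, ‖natVec M‖ :=
        Finset.sum_le_sum fun i _ => Finset.sum_le_sum fun j _ => entry_le_norm _ _
    _ = _ := by simp; ring

theorem norm_natVec_le_total (M : NMat n) : ‖natVec M‖ ≤ total (natVec M) := by
  have h0 : 0 ≤ total (natVec M) :=
    Finset.sum_nonneg fun i _ => Finset.sum_nonneg fun j _ => natVec_nonneg M _
  refine le_of_sq_le_sq ?_ h0
  rw [norm_sq_eq_sum, total, sq (∑ i, ∑ j, natVec M (i, j)), Finset.sum_mul]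
  refine Finset.sum_le_sum fun i _ => ?_
  rw [Finset.sum_mul]
  refine Finset.sum_le_sum fun j _ => ?_
  rw [sq]
  refine mul_le_mul_of_nonneg_left ?_ (natVec_nonneg M _)
  refine (Finset.single_le_sum (f := fun j => natVec M (i, j))
    (fun j _ => natVec_nonneg M _) (Finset.mem_univ j)).trans ?_
  exact Finset.single_le_sum (f := fun i => ∑ j, natVec M (i, j))
    (fun i _ => Finset.sum_nonneg fun j _ => natVec_nonneg M _) (Finset.mem_univ i)

end Geometry

/-! ### One time slot -/

section Slot

variable {n : ℕ} {q q' a s : NMat n} {ν : Matrix (Fin n) (Fin n) ℝ} {aMax : ℕ}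

/-- The unused service `u` in `q' = q + a - s + u`. -/
def unused (q q' a s : NMat n) : Vec n := natVec q' - natVec q - natVec a + natVec s

theorem natVec_eq_add_unused (q q' a s : NMat n) :
    natVec q' = natVec q + (natVec a - natVec s) + unused q q' a s := by
  rw [unused]
  abel

theorem schedule_le_one (hs : IsSchedule s) (i j : Fin n) : s i j ≤ 1 := by
  obtain ⟨τ, h⟩ := hs
  rw [h]
  split_ifs <;> simp

/-- Service is wasted only on an empty queue without arrivals, and that queue stays empty. So `u`
has entries 0 or 1 and is orthogonal to the queue both before and after the slot. -/
theorem unused_cases (hs : IsSchedule s) (hq : ∀ i j, q' i j = q i j + a i j - s i j)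
    (i j : Fin n) : unused q q' a s (i, j) = 0 ∨
      unused q q' a s (i, j) = 1 ∧ natVec q (i, j) = 0 ∧ natVec q' (i, j) = 0 := by
  have h1 := schedule_le_one hs i j
  have h2 := hq i j
  simp only [unused, PiLp.add_apply, PiLp.sub_apply, natVec_apply]
  rcases le_or_gt (s i j) (q i j + a i j) with h | h
  · left
    have : (q' i j : ℝ) + s i j = q i j + a i j := by
      have : q' i j + s i j = q i j + a i j := by omega
      exact_mod_cast this
    linarith
  · right
    have e1 : q i j = 0 := by omega
    have e2 : a i j = 0 := by omega
    have e3 : s i j = 1 := by omega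
    have e4 : q' i j = 0 := by omega
    simp [e1, e2, e3, e4]

theorem unused_nonneg (hs : IsSchedule s) (hq : ∀ i j, q' i j = q i j + a i j - s i j)
    (p : Fin n × Fin n) : 0 ≤ unused q q' a s p := by
  rcases unused_cases hs hq p.1 p.2 with h | ⟨h, -⟩ <;> simp [h]

theorem inner_queue_unused (hs : IsSchedule s) (hq : ∀ i j, q' i j = q i j + a i j - s i j) :
    inner ℝ (natVec q) (unused q q' a s) = 0 := by
  rw [inner_eq_sum]
  refine Finset.sum_eq_zero fun i _ => Finset.sum_eq_zero fun j _ => ?_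
  rcases unused_cases hs hq i j with h | ⟨-, h, -⟩ <;> simp only [h, mul_zero, zero_mul]

theorem inner_next_queue_unused (hs : IsSchedule s)
    (hq : ∀ i j, q' i j = q i j + a i j - s i j) :
    inner ℝ (natVec q') (unused q q' a s) = 0 := by
  rw [inner_eq_sum]
  refine Finset.sum_eq_zero fun i _ => Finset.sum_eq_zero fun j _ => ?_
  rcases unused_cases hs hq i j with h | ⟨-, -, h⟩ <;> simp only [h, mul_zero, zero_mul]

theorem inner_coneK_unused_nonneg (hs : IsSchedule s)
    (hq : ∀ i j, q' i j = q i j + a i j - s i j) {p : Vec n} (hp : p ∈ coneK n) :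
    0 ≤ inner ℝ p (unused q q' a s) := by
  rw [inner_eq_sum]
  exact Finset.sum_nonneg fun i _ => Finset.sum_nonneg fun j _ =>
    mul_nonneg (hp.2 _) (unused_nonneg hs hq _)

theorem norm_unused_sq (hs : IsSchedule s) (hq : ∀ i j, q' i j = q i j + a i j - s i j) :
    ‖unused q q' a s‖ ^ 2 = total (unused q q' a s) := by
  rw [norm_sq_eq_sum, total]
  refine Finset.sum_congr rfl fun i _ => Finset.sum_congr rfl fun j _ => ?_
  rcases unused_cases hs hq i j with h | ⟨h, -⟩ <;> simp [h]

/-- Expresses the total unused service by queue totals and arrivals, so that its stationary mean can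
be read off from invariance. -/
theorem total_unused (hs : IsSchedule s) :
    total (unused q q' a s) = total (natVec q') - total (natVec q) - total (natVec a) + n := by
  rw [← (unitSums_of_isSchedule hs).total_eq]
  simp only [total, unused, PiLp.add_apply, PiLp.sub_apply, Finset.sum_add_distrib,
    Finset.sum_sub_distrib]

theorem norm_queue_sub_le (hs : IsSchedule s) (hq : ∀ i j, q' i j = q i j + a i j - s i j)
    (ha : ∀ i j, a i j ≤ aMax) : ‖natVec q' - natVec q‖ ≤ n * (aMax + 1) := by
  refine le_of_sq_le_sq ?_ (by positivity)
  rw [norm_sq_eq_sum]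
  calc _ ≤ ∑ _i : Fin n, ∑ _j : Fin n, ((aMax : ℝ) + 1) ^ 2 := by
        refine Finset.sum_le_sum fun i _ => Finset.sum_le_sum fun j _ => ?_
        have h1 := schedule_le_one hs i j
        have h2 := hq i j
        have h3 := ha i j
        have h4 : (q' i j : ℝ) ≤ q i j + aMax := by
          have : q' i j ≤ q i j + aMax := by omega
          exact_mod_cast this
        have h5 : (q i j : ℝ) ≤ q' i j + 1 := by
          have : q i j ≤ q' i j + 1 := by omega
          exact_mod_cast this
        have h6 : (0 : ℝ) ≤ aMax := by positivity
        simp only [PiLp.sub_apply, natVec_apply]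
        apply sq_le_sq' <;> linarith
    _ = _ := by simp; ring

/-- In the cross term `⟨q - p, a - s + u⟩`, `u` is orthogonal to `q`, `⟨p, u⟩ ≥ 0` has the
favourable sign, and `⟨p, s⟩` may be replaced by `⟨p, ν⟩`. Only `⟨q, s⟩` still depends on the
algorithm. -/
theorem norm_sub_sq_le (hs : IsSchedule s) (hq : ∀ i j, q' i j = q i j + a i j - s i j)
    (ha : ∀ i j, a i j ≤ aMax) (hν : UnitSums (vec ν)) {p : Vec n} (hp : p ∈ coneK n) :
    ‖natVec q' - p‖ ^ 2 ≤ ‖natVec q - p‖ ^ 2 +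
      2 * (inner ℝ (natVec q - p) (natVec a) - inner ℝ (natVec q) (natVec s) +
        inner ℝ p (vec ν)) + (n * (aMax + 1)) ^ 2 := by
  have hd : natVec q' - p = (natVec q - p) + (natVec q' - natVec q) := by abel
  have hd2 : natVec q' - natVec q = natVec a - natVec s + unused q q' a s := by
    rw [unused]; abel
  have h1 : inner ℝ (natVec q - p) (natVec q' - natVec q) ≤
      inner ℝ (natVec q - p) (natVec a) - inner ℝ (natVec q) (natVec s) + inner ℝ p (vec ν) := by
    have e1 := inner_queue_unused hs hq
    have e2 := inner_coneK_unused_nonneg hs hq hp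
    have e3 := inner_eq_of_unitSums hp.1 (unitSums_of_isSchedule hs) hν
    rw [hd2, inner_add_right, inner_sub_right, inner_sub_left _ _ (natVec s),
      inner_sub_left _ _ (unused q q' a s)]
    linarith
  have h2 : ‖natVec q' - natVec q‖ ^ 2 ≤ (n * (aMax + 1)) ^ 2 :=
    pow_le_pow_left₀ (norm_nonneg _) (norm_queue_sub_le hs hq ha) 2
  rw [hd, norm_add_sq_real]
  linarith

/-- Expand the quadratic form of `q' - u = q + a - s` in two ways. The schedule drops out since its
projection equals that of `ν`. What remains are terms in `u`, bounded by `‖q'_⊥‖ ‖u‖` and `‖u‖²`,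
where `‖u‖²` is the total of `u`. -/
theorem abs_inner_projS_step_le (hn : 0 < n) {c : ℝ}
    (hc : ∀ x : Vec n, ‖projS n x‖ ≤ c * ‖x‖) {δ : ℝ} (hδ : 0 < δ)
    (hs : IsSchedule s) (hq : ∀ i j, q' i j = q i j + a i j - s i j) (hν : UnitSums (vec ν)) :
    |inner ℝ (projS n (natVec q')) (natVec q') - inner ℝ (projS n (natVec q)) (natVec q) -
        2 * (inner ℝ (projS n (natVec q)) (natVec a) - total (natVec q) / n) -
        inner ℝ (projS n (natVec a - vec ν)) (natVec a - vec ν)| ≤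
      δ * ‖perpK (natVec q')‖ ^ 2 + ((1 + c) ^ 2 / δ + c) *
        (total (natVec q') - total (natVec q) - total (natVec a) + n) := by
  rw [← total_unused (q' := q') hs, ← norm_unused_sq hs hq]
  set u := unused q q' a s with hu
  have hsu := unitSums_of_isSchedule hs
  have hproj : projS n (natVec a - natVec s) = projS n (natVec a - vec ν) := by
    rw [map_sub, map_sub, projS_of_unitSums hn hsu, projS_of_unitSums hn hν]
  have e1 : inner ℝ (projS n (natVec a - natVec s)) (natVec a - natVec s) =
      inner ℝ (projS n (natVec a - vec ν)) (natVec a - vec ν) := by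
    rw [inner_projS_comm, ← hproj, hproj, inner_sub_right, inner_sub_right,
      inner_projS_of_unitSums hn hsu, inner_projS_of_unitSums hn hν]
  have e2 : inner ℝ (projS n (natVec q)) (natVec a - natVec s) =
      inner ℝ (projS n (natVec q)) (natVec a) - total (natVec q) / n := by
    rw [inner_sub_right, inner_projS_of_unitSums hn hsu]
  have e3 : inner ℝ (projS n (natVec q' - u)) (natVec q' - u) =
      inner ℝ (projS n (natVec q)) (natVec q) +
        2 * inner ℝ (projS n (natVec q)) (natVec a - natVec s) +
        inner ℝ (projS n (natVec a - natVec s)) (natVec a - natVec s) := by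
    have : natVec q' - u = natVec q + (natVec a - natVec s) := by
      rw [natVec_eq_add_unused q q' a s]; abel
    rw [this, map_add, inner_add_left, inner_add_right, inner_add_right,
      inner_projS_comm (natVec a - natVec s) (natVec q)]
    ring
  have e4 : inner ℝ (projS n (natVec q' - u)) (natVec q' - u) =
      inner ℝ (projS n (natVec q')) (natVec q') - 2 * inner ℝ (projS n (natVec q')) u +
        inner ℝ (projS n u) u := by
    rw [map_sub, inner_sub_left, inner_sub_right, inner_sub_right,
      inner_projS_comm u (natVec q')]
    ring
  -- The part of `q'` in the cone is fixed by the projection, and `q'` is orthogonal to `u`. So only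
  -- the perpendicular part of `q'` survives.
  have e5 : inner ℝ (projS n (natVec q')) u =
      inner ℝ (projS n (perpK (natVec q'))) u - inner ℝ (perpK (natVec q')) u := by
    have h0 : inner ℝ (natVec q') u = 0 := inner_next_queue_unused hs hq
    have h1 : natVec q' = projK (natVec q') + perpK (natVec q') := by rw [perpK]; abel
    have h2 : projS n (natVec q') = projK (natVec q') + projS n (perpK (natVec q')) := by
      conv_lhs => rw [h1, map_add, projS_of_mem hn (projK_mem _).1]
    rw [h2, inner_add_left]
    have h3 : inner ℝ (projK (natVec q')) u + inner ℝ (perpK (natVec q')) u = 0 := by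
      rw [← inner_add_left, ← h1, h0]
    linarith
  have b1 : |inner ℝ (projS n (natVec q')) u| ≤ (1 + c) * (‖perpK (natVec q')‖ * ‖u‖) := by
    rw [e5]
    refine (abs_sub _ _).trans ?_
    have h1 := abs_real_inner_le_norm (projS n (perpK (natVec q'))) u
    have h2 := abs_real_inner_le_norm (perpK (natVec q')) u
    have h3 := mul_le_mul_of_nonneg_right (hc (perpK (natVec q'))) (norm_nonneg u)
    linarith
  have b2 : |inner ℝ (projS n u) u| ≤ c * ‖u‖ ^ 2 := by
    have h1 := abs_real_inner_le_norm (projS n u) u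
    have h3 := mul_le_mul_of_nonneg_right (hc u) (norm_nonneg u)
    nlinarith
  -- Young's inequality with free weight `δ`.
  have b3 : 2 * ((1 + c) * (‖perpK (natVec q')‖ * ‖u‖)) ≤
      δ * ‖perpK (natVec q')‖ ^ 2 + (1 + c) ^ 2 / δ * ‖u‖ ^ 2 := by
    have h : 0 ≤ (δ * ‖perpK (natVec q')‖ - (1 + c) * ‖u‖) ^ 2 / δ := by positivity
    have h' : (δ * ‖perpK (natVec q')‖ - (1 + c) * ‖u‖) ^ 2 / δ =
        δ * ‖perpK (natVec q')‖ ^ 2 - 2 * ((1 + c) * (‖perpK (natVec q')‖ * ‖u‖)) +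
          (1 + c) ^ 2 / δ * ‖u‖ ^ 2 := by
      field_simp
      ring
    linarith
  rw [abs_le] at b1 b2 ⊢
  constructor <;> nlinarith

end Slot

/-! ### Integration against an invariant distribution -/

section Invariant

variable {A : Type v} [Countable A] [MeasurableSpace A] [DiscreteMeasurableSpace A]
  {P : A → PMF A} {π : PMF A}

theorem lintegral_toMeasure (p : PMF A) (f : A → ENNReal) :
    ∫⁻ y, f y ∂p.toMeasure = ∑' y, p y * f y := by
  rw [lintegral_countable']
  refine tsum_congr fun y => ?_
  rw [PMF.toMeasure_apply_singleton _ _ (MeasurableSet.of_discrete), mul_comm]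

theorem integral_invariant (hπ : π.bind P = π) {f : A → ℝ} (hf : Integrable f π.toMeasure) :
    Integrable (fun x => ∫ y, f y ∂(P x).toMeasure) π.toMeasure ∧
      ∫ x, ∫ y, f y ∂(P x).toMeasure ∂π.toMeasure = ∫ x, f x ∂π.toMeasure := by
  let η : Kernel A A := ⟨fun x => (P x).toMeasure, measurable_of_countable _⟩
  have hcomp : (η ∘ₖ Kernel.const Unit π.toMeasure) () = π.toMeasure := by
    refine Measure.ext_of_singleton fun y => ?_
    rw [Kernel.comp_apply' _ _ _ MeasurableSet.of_discrete, Kernel.const_apply,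
      lintegral_toMeasure, PMF.toMeasure_apply_singleton _ _ MeasurableSet.of_discrete]
    conv_rhs => rw [← hπ, PMF.bind_apply]
    refine tsum_congr fun x => ?_
    congr 1
    exact PMF.toMeasure_apply_singleton _ _ MeasurableSet.of_discrete
  have hf' : Integrable f ((η ∘ₖ Kernel.const Unit π.toMeasure) ()) := by rwa [hcomp]
  refine ⟨hf'.integral_comp, ?_⟩
  have := Kernel.integral_comp hf'
  rw [hcomp] at this
  exact this.symm

end Invariant

/-! ### The chain of a switch -/

namespace SwitchSystem

variable {n : ℕ} (S : SwitchSystem.{u, v} n)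

instance instMeasurableSpaceState : MeasurableSpace S.A := ⊤

instance instDiscreteMeasurableSpaceState : DiscreteMeasurableSpace S.A := ⟨fun _ => trivial⟩

theorem measurable_X (t : ℕ) : Measurable (S.X t) := measurable_to_countable' (S.measurableSet_X t)

theorem measure_eq_tsum_fiber {Ω : Type*} [MeasurableSpace Ω] (μ : Measure Ω) {B : Type*}
    [Countable B] [MeasurableSpace B] [MeasurableSingletonClass B] {Y : Ω → B} (hY : Measurable Y)
    {E : Set Ω} (hE : MeasurableSet E) : μ E = ∑' b, μ (E ∩ Y ⁻¹' {b}) := by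
  rw [← measure_iUnion]
  · congr 1
    ext ω
    simp
  · intro b c hbc
    refine Set.disjoint_left.2 fun ω h₁ h₂ => hbc ?_
    exact (h₁.2 : Y ω = b).symm.trans h₂.2
  · exact fun b => hE.inter (hY (measurableSet_singleton b))

/-- Sums the path form of the Markov property over all histories that end in `x`. -/
theorem measure_X_step (t : ℕ) (x y : S.A) :
    S.μ ({ω | S.X t ω = x} ∩ {ω | S.X (t + 1) ω = y}) = S.μ {ω | S.X t ω = x} * S.P x y := by
  let Φ : S.Ω → Fin (t + 1) → S.A := fun ω k => S.X k ω
  have hΦ : Measurable Φ := measurable_pi_lambda _ fun k => S.measurable_X k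
  have h1 := measure_eq_tsum_fiber S.μ hΦ ((S.measurableSet_X t x).inter
    (S.measurableSet_X (t + 1) y))
  have h2 := measure_eq_tsum_fiber S.μ hΦ (S.measurableSet_X t x)
  rw [h1, h2, ← ENNReal.tsum_mul_right]
  refine tsum_congr fun p => ?_
  by_cases hp : p (Fin.last t) = x
  · let path : ℕ → S.A := fun k => if h : k < t + 1 then p ⟨k, h⟩ else y
    have e0 : ∀ k (h : k < t + 1), path k = p ⟨k, h⟩ := fun k h => dif_pos h
    have e1 : path t = x := by rw [e0 t (by omega), ← hp]; rfl
    have e2 : path (t + 1) = y := by simp [path]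
    have hΦp : ∀ ω, Φ ω = p ↔ ∀ k ≤ t, S.X k ω = path k := by
      intro ω
      constructor
      · intro h k hk
        rw [e0 k (by omega), ← h]
      · intro h
        funext k
        rw [← e0 k k.2, ← h k (by omega)]
    have m1 : {ω | S.X t ω = x} ∩ {ω | S.X (t + 1) ω = y} ∩ Φ ⁻¹' {p} =
        {ω | ∀ k ≤ t + 1, S.X k ω = path k} := by
      ext ω
      simp only [Set.mem_inter_iff, Set.mem_ofPred_eq, Set.mem_preimage, Set.mem_singleton_iff, hΦp]
      constructor
      · rintro ⟨⟨-, h⟩, h'⟩ k hk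
        rcases Nat.lt_or_ge t k with hk' | hk'
        · obtain rfl : k = t + 1 := by omega
          rw [h, e2]
        · exact h' k hk'
      · intro h
        exact ⟨⟨by rw [h t (by omega), e1], by rw [h (t + 1) le_rfl, e2]⟩,
          fun k hk => h k (by omega)⟩
    have m2 : {ω | S.X t ω = x} ∩ Φ ⁻¹' {p} = {ω | ∀ k ≤ t, S.X k ω = path k} := by
      ext ω
      simp only [Set.mem_inter_iff, Set.mem_ofPred_eq, Set.mem_preimage, Set.mem_singleton_iff, hΦp]
      exact ⟨fun h => h.2, fun h => ⟨by rw [h t le_rfl, e1], h⟩⟩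
    rw [m1, m2, S.markov t path, e1, e2]
  · have : {ω | S.X t ω = x} ∩ Φ ⁻¹' {p} = ∅ := by
      ext ω
      simp only [Set.mem_inter_iff, Set.mem_ofPred_eq, Set.mem_preimage, Set.mem_singleton_iff,
        Set.mem_empty_iff_false, iff_false, not_and]
      intro h h'
      exact hp (by rw [← h', ← h]; rfl)
    rw [Set.inter_right_comm, this]
    simp

/-- The initial distribution of the chain. -/
def initDist : PMF S.A :=
  ⟨fun x => S.μ {ω | S.X 0 ω = x}, by
    have := measure_eq_tsum_fiber S.μ (S.measurable_X 0) MeasurableSet.univ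
    simp only [measure_univ, Set.univ_inter] at this
    rw [this]
    exact ENNReal.summable.hasSum⟩

theorem initDist_apply (x : S.A) : S.initDist x = S.μ {ω | S.X 0 ω = x} := rfl

theorem measure_X (t : ℕ) (y : S.A) :
    S.μ {ω | S.X t ω = y} = S.initDist.bind (stepDist S.P t) y := by
  induction t generalizing y with
  | zero =>
    have : stepDist S.P 0 = PMF.pure := rfl
    rw [this, PMF.bind_pure, initDist_apply]
  | succ t ih =>
    rw [measure_eq_tsum_fiber S.μ (S.measurable_X t) (S.measurableSet_X (t + 1) y)]
    have hb : S.initDist.bind (stepDist S.P (t + 1)) =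
        (S.initDist.bind (stepDist S.P t)).bind S.P := by
      rw [PMF.bind_bind]
      exact congrArg _ (funext fun x => stepDist_succ_right S.P t x)
    rw [hb, PMF.bind_apply]
    refine tsum_congr fun x => ?_
    rw [← ih x, ← S.measure_X_step t x y, Set.inter_comm]
    rfl

/-- The class condition speaks only of states visited with positive probability. By irreducibility
every state is visited at some time, so the drift bounds hold for every row of the transition
matrix. -/
theorem exists_measure_X_ne_zero (hirr : Irreducible S.P) (y : S.A) :
    ∃ t, S.μ {ω | S.X t ω = y} ≠ 0 := by
  obtain ⟨x, hx⟩ := S.initDist.support_nonempty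
  obtain ⟨k, hk⟩ := hirr x y
  refine ⟨k, ?_⟩
  rw [measure_X, PMF.bind_apply]
  intro h
  exact mul_ne_zero ((PMF.mem_support_iff _ _).1 hx) hk (ENNReal.tsum_eq_zero.1 h x)

/-- The conditional law given `X(t) = x`. -/
abbrev condX (t : ℕ) (x : S.A) : Measure S.Ω := ProbabilityTheory.cond S.μ {ω | S.X t ω = x}

variable {S} {t : ℕ} {x : S.A}

theorem isProbabilityMeasure_condX (hx : S.μ {ω | S.X t ω = x} ≠ 0) :
    IsProbabilityMeasure (S.condX t x) := cond_isProbabilityMeasure hx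

theorem ae_condX : ∀ᵐ ω ∂S.condX t x, S.X t ω = x := ae_cond_mem (S.measurableSet_X t x)

theorem map_X_condX (hx : S.μ {ω | S.X t ω = x} ≠ 0) :
    (S.condX t x).map (S.X (t + 1)) = (S.P x).toMeasure := by
  refine Measure.ext_of_singleton fun y => ?_
  rw [Measure.map_apply (S.measurable_X _) MeasurableSet.of_discrete,
    PMF.toMeasure_apply_singleton _ _ MeasurableSet.of_discrete,
    cond_apply (S.measurableSet_X t x)]
  change _ * S.μ (_ ∩ {ω | S.X (t + 1) ω = y}) = _
  rw [S.measure_X_step, ← mul_assoc, ENNReal.inv_mul_cancel hx (by finiteness), one_mul]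

/-- The event `X(t) = x` belongs to the history by A.1, and the arrivals are independent of the
history. -/
theorem map_a_condX (hA : S.CondA1) (hx : S.μ {ω | S.X t ω = x} ≠ 0) :
    (S.condX t x).map (S.a t) = S.μ.map (S.a t) := by
  ext B hB
  rw [Measure.map_apply (S.measurable_a t) hB, Measure.map_apply (S.measurable_a t) hB,
    cond_apply (S.measurableSet_X t x), Set.inter_comm,
    (Indep_iff _ _ _).1 (S.nonanticipating t) _ _ ⟨B, hB, rfl⟩ (hA.1 t x), mul_comm (S.μ _),
    ← mul_assoc, ENNReal.inv_mul_cancel hx (by finiteness), one_mul]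

theorem integral_a_condX (hA : S.CondA1) (hx : S.μ {ω | S.X t ω = x} ≠ 0) (φ : NMat n → ℝ) :
    ∫ ω, φ (S.a t ω) ∂S.condX t x = ∫ ω, φ (S.a t ω) ∂S.μ := by
  have hφ : ∀ m : Measure (NMat n), AEStronglyMeasurable φ m := fun m =>
    (measurable_of_countable φ).aestronglyMeasurable
  rw [← integral_map (S.measurable_a t).aemeasurable (hφ _), map_a_condX hA hx,
    integral_map (S.measurable_a t).aemeasurable (hφ _)]

theorem integral_P (hA : S.CondA2) (hx : S.μ {ω | S.X t ω = x} ≠ 0) (φ : NMat n → ℝ) :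
    ∫ y, φ (S.g y) ∂(S.P x).toMeasure = ∫ ω, φ (S.q (t + 1) ω) ∂S.condX t x := by
  rw [← map_X_condX hx, integral_map (S.measurable_X _).aemeasurable
    (measurable_of_countable _).aestronglyMeasurable]
  simp only [hA.1]

theorem integrable_of_le {Ω : Type*} [MeasurableSpace Ω] (m : Measure Ω) [IsFiniteMeasure m]
    {Z : Ω → NMat n} (hZ : Measurable Z) {b : NMat n} (hb : ∀ᵐ ω ∂m, ∀ i j, Z ω i j ≤ b i j)
    (φ : NMat n → ℝ) : Integrable (fun ω => φ (Z ω)) m := by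
  obtain ⟨C, hC⟩ := ((Set.finite_Icc (0 : NMat n) b).image fun M => ‖φ M‖).bddAbove
  refine Integrable.of_bound (C := C)
    ((measurable_of_countable φ).comp hZ).aestronglyMeasurable ?_
  filter_upwards [hb] with ω h
  exact hC ⟨Z ω, ⟨fun i j => Nat.zero_le _, fun i j => h i j⟩, rfl⟩

variable {aMax : ℕ}

theorem integrable_a (harr : S.ArrivalAssumption aMax) (m : Measure S.Ω) [IsFiniteMeasure m]
    (φ : NMat n → ℝ) : Integrable (fun ω => φ (S.a t ω)) m :=
  integrable_of_le m (S.measurable_a t) (b := fun _ _ => aMax)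
    (Eventually.of_forall fun ω => harr.bounded t ω) φ

theorem integrable_s (m : Measure S.Ω) [IsFiniteMeasure m] (φ : NMat n → ℝ) :
    Integrable (fun ω => φ (S.s t ω)) m :=
  integrable_of_le m (S.measurable_s t) (b := fun _ _ => 1)
    (Eventually.of_forall fun ω => schedule_le_one (S.isSchedule_s t ω)) φ

theorem ae_q_condX (hA : S.CondA2) : ∀ᵐ ω ∂S.condX t x, S.q t ω = S.g x := by
  filter_upwards [ae_condX (S := S) (t := t) (x := x)] with ω h
  rw [hA.1, h]

theorem integrable_q (harr : S.ArrivalAssumption aMax) (hA : S.CondA2)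
    [IsFiniteMeasure (S.condX t x)] (φ : NMat n → ℝ) :
    Integrable (fun ω => φ (S.q (t + 1) ω)) (S.condX t x) := by
  refine integrable_of_le _ (S.measurable_q _) (b := fun i j => S.g x i j + aMax) ?_ φ
  filter_upwards [ae_q_condX hA] with ω h i j
  have := harr.bounded t ω i j
  rw [S.queue_eq, h]
  omega

theorem tsum_P (harr : S.ArrivalAssumption aMax) (hA : S.CondA2)
    (hx : S.μ {ω | S.X t ω = x} ≠ 0) {φ : NMat n → ℝ} (hφ : ∀ M, 0 ≤ φ M) :
    ∑' y, S.P x y * ENNReal.ofReal (φ (S.g y)) =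
      ENNReal.ofReal (∫ ω, φ (S.q (t + 1) ω) ∂S.condX t x) := by
  have := isProbabilityMeasure_condX hx
  rw [← lintegral_toMeasure, ofReal_integral_eq_lintegral_ofReal (integrable_q harr hA φ)
    (Eventually.of_forall fun ω => hφ _), ← map_X_condX hx,
    lintegral_map (measurable_of_countable _) (S.measurable_X _)]
  simp only [hA.1]

theorem integral_arrival (harr : S.ArrivalAssumption aMax) (i j : Fin n) :
    ∫ ω, (S.a t ω i j : ℝ) ∂S.μ = S.rate i j :=
  ((harr.ident i j t).comp (u := fun k : ℕ => (k : ℝ)) (measurable_of_countable _)).integral_eq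

theorem integral_inner_a (harr : S.ArrivalAssumption aMax) {ν : Matrix (Fin n) (Fin n) ℝ} {ε : ℝ}
    (hrate : ∀ i j, S.rate i j = (1 - ε) * ν i j) (c : Vec n) :
    ∫ ω, inner ℝ c (natVec (S.a t ω)) ∂S.μ = (1 - ε) * inner ℝ c (vec ν) := by
  simp only [inner_eq_sum, natVec_apply]
  rw [integral_finsetSum _ fun i _ => integrable_a harr _
    fun M => ∑ j, c (i, j) * (M i j : ℝ), Finset.mul_sum]
  refine Finset.sum_congr rfl fun i _ => ?_
  rw [integral_finsetSum _ fun j _ => integrable_a harr _ fun M => c (i, j) * (M i j : ℝ),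
    Finset.mul_sum]
  refine Finset.sum_congr rfl fun j _ => ?_
  rw [integral_const_mul, integral_arrival harr, hrate, mul_left_comm]
  rfl

theorem integral_total_a (harr : S.ArrivalAssumption aMax) {ν : Matrix (Fin n) (Fin n) ℝ} {ε : ℝ}
    (hrate : ∀ i j, S.rate i j = (1 - ε) * ν i j) (hν : UnitSums (vec ν)) :
    ∫ ω, total (natVec (S.a t ω)) ∂S.μ = (1 - ε) * n := by
  have h : ∀ y : Vec n, total y = inner ℝ (vec fun _ _ => 1) y := fun y => by
    simp [inner_eq_sum, total]
  simp only [h (natVec _)]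
  rw [integral_inner_a harr hrate, ← h, hν.total_eq]

/-- The second moment of a sum of arrivals around a point. -/
theorem integral_sum_sub_sq (harr : S.ArrivalAssumption aMax) (F : Finset (Fin n × Fin n)) (c : ℝ) :
    ∫ ω, (∑ p ∈ F, (S.a t ω p.1 p.2 : ℝ) - c) ^ 2 ∂S.μ =
      ∑ p ∈ F, S.arrivalVar p.1 p.2 + (∑ p ∈ F, S.rate p.1 p.2 - c) ^ 2 := by
  let Y : Fin n × Fin n → S.Ω → ℝ := fun p ω => S.a t ω p.1 p.2
  have hYm : ∀ p, Measurable (Y p) := fun p =>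
    (measurable_of_countable fun M : NMat n => (M p.1 p.2 : ℝ)).comp (S.measurable_a t)
  have hY : ∀ p, MemLp (Y p) 2 S.μ := fun p =>
    MemLp.of_bound (hYm p).aestronglyMeasurable aMax (Eventually.of_forall fun ω => by
      have : (S.a t ω p.1 p.2 : ℝ) ≤ aMax := by exact_mod_cast harr.bounded t ω p.1 p.2
      simpa [Y] using this)
  have hvar : ∀ p, variance (Y p) S.μ = S.arrivalVar p.1 p.2 := fun p =>
    ((harr.ident p.1 p.2 t).comp (u := fun k : ℕ => (k : ℝ)) (measurable_of_countable _)).variance_eq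
  have hsum : variance (∑ p ∈ F, Y p) S.μ = ∑ p ∈ F, S.arrivalVar p.1 p.2 := by
    rw [IndepFun.variance_sum (fun p _ => hY p)]
    · exact Finset.sum_congr rfl fun p _ => hvar p
    · intro p _ p' _ hpp
      exact (harr.indep_pairs t p.1 p.2 p'.1 p'.2 (by simpa using hpp)).comp
        (measurable_of_countable fun k : ℕ => (k : ℝ)) (measurable_of_countable fun k : ℕ => (k : ℝ))
  have hmem : MemLp (∑ p ∈ F, Y p) 2 S.μ := memLp_finsetSum' F fun p _ => hY p
  have hmean : ∫ ω, (∑ p ∈ F, Y p) ω ∂S.μ = ∑ p ∈ F, S.rate p.1 p.2 := by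
    simp only [Finset.sum_apply]
    rw [integral_finsetSum _ fun p _ => (hY p).integrable one_le_two]
    exact Finset.sum_congr rfl fun p _ => integral_arrival harr _ _
  have hv := variance_eq_sub hmem
  rw [hsum, hmean] at hv
  have hsq : Integrable (fun ω => (∑ p ∈ F, Y p) ω ^ 2) S.μ := hmem.integrable_sq
  have hlin : Integrable (fun ω => (∑ p ∈ F, Y p) ω) S.μ := hmem.integrable one_le_two
  have hlin' : Integrable (fun ω => 2 * c * (∑ p ∈ F, Y p) ω) S.μ := hlin.const_mul _
  have hsub : Integrable (fun ω => (∑ p ∈ F, Y p) ω ^ 2 - 2 * c * (∑ p ∈ F, Y p) ω) S.μ :=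
    hsq.sub hlin'
  have hexp : ∀ ω, (∑ p ∈ F, (S.a t ω p.1 p.2 : ℝ) - c) ^ 2 =
      (∑ p ∈ F, Y p) ω ^ 2 - 2 * c * (∑ p ∈ F, Y p) ω + c ^ 2 := by
    intro ω
    simp only [Finset.sum_apply, Y]
    ring
  simp only [hexp]
  rw [integral_add hsub (integrable_const _), integral_sub hsq hlin', integral_const_mul, hmean]
  simp only [integral_const, probReal_univ, smul_eq_mul, one_mul, Pi.pow_apply] at hv ⊢
  linarith

end SwitchSystem

theorem finite_natVec_norm_le {n : ℕ} (R : ℝ) : {M : NMat n | ‖natVec M‖ ≤ R}.Finite := by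
  refine (Set.finite_Icc (0 : NMat n) fun _ _ => ⌈R⌉₊).subset fun M hM => ?_
  refine ⟨fun i j => Nat.zero_le _, fun i j => ?_⟩
  have h : (M i j : ℝ) ≤ ⌈R⌉₊ := (entry_le_norm (natVec M) (i, j)).trans (hM.trans (Nat.le_ceil R))
  exact_mod_cast h

theorem pow_le_mul_exp {θ w : ℝ} (hθ : 0 < θ) (hw : 0 ≤ w) (r : ℕ) :
    w ^ r ≤ r.factorial / θ ^ r * Real.exp (θ * w) := by
  have h := Real.pow_div_factorial_le_exp (θ * w) (by positivity) r
  rw [div_le_iff₀ (by positivity), mul_pow] at h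
  rw [div_mul_eq_mul_div, le_div_iff₀ (by positivity)]
  linarith

/-! ### Lyapunov drift of the queue lengths -/

namespace SwitchSystem

variable {n : ℕ} {S : SwitchSystem.{u, v} n} {ν : Matrix (Fin n) (Fin n) ℝ} {aMax : ℕ} {ε W : ℝ}

/-- The drift condition that defines the class, for a single system. -/
def DriftCondition (S : SwitchSystem.{u, v} n) (ν : Matrix (Fin n) (Fin n) ℝ) (W : ℝ) : Prop :=
  ∀ (t : ℕ) (x : S.A), S.μ {ω | S.X t ω = x} ≠ 0 →
    inner ℝ (natVec (S.g x)) (vec ν) + W * ‖perpK (natVec (S.g x))‖ ≤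
      ∫ ω, inner ℝ (natVec (S.q t ω)) (natVec (S.s t ω)) ∂S.condX t x

/-- The drift of the squared distance to a point of the cone. -/
theorem integral_norm_sub_sq_le (harr : S.ArrivalAssumption aMax) (hA₁ : S.CondA1) (hA₂ : S.CondA2)
    (hν : UnitSums (vec ν)) (hrate : ∀ i j, S.rate i j = (1 - ε) * ν i j)
    (hW : S.DriftCondition ν W) {t : ℕ} {x : S.A} (hx : S.μ {ω | S.X t ω = x} ≠ 0) {p : Vec n}
    (hp : p ∈ coneK n) :
    ∫ ω, ‖natVec (S.q (t + 1) ω) - p‖ ^ 2 ∂S.condX t x ≤ ‖natVec (S.g x) - p‖ ^ 2 -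
      2 * (ε * inner ℝ (natVec (S.g x) - p) (vec ν) + W * ‖perpK (natVec (S.g x))‖) +
      (n * (aMax + 1)) ^ 2 := by
  have := isProbabilityMeasure_condX hx
  have hIa : Integrable (fun ω => inner ℝ (natVec (S.g x) - p) (natVec (S.a t ω))) (S.condX t x) :=
    integrable_a harr _ fun M => inner ℝ (natVec (S.g x) - p) (natVec M)
  have hIs : Integrable (fun ω => inner ℝ (natVec (S.g x)) (natVec (S.s t ω))) (S.condX t x) :=
    integrable_s _ fun M => inner ℝ (natVec (S.g x)) (natVec M)
  have h1 : ∫ ω, inner ℝ (natVec (S.g x) - p) (natVec (S.a t ω)) ∂S.condX t x =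
      (1 - ε) * inner ℝ (natVec (S.g x) - p) (vec ν) := by
    rw [integral_a_condX hA₁ hx fun M => inner ℝ (natVec (S.g x) - p) (natVec M),
      integral_inner_a harr hrate]
  have h2 : inner ℝ (natVec (S.g x)) (vec ν) + W * ‖perpK (natVec (S.g x))‖ ≤
      ∫ ω, inner ℝ (natVec (S.g x)) (natVec (S.s t ω)) ∂S.condX t x := by
    refine (hW t x hx).trans_eq (integral_congr_ae ?_)
    filter_upwards [ae_q_condX hA₂] with ω h
    rw [h]
  have hsub : Integrable (fun ω => inner ℝ (natVec (S.g x) - p) (natVec (S.a t ω)) -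
      inner ℝ (natVec (S.g x)) (natVec (S.s t ω))) (S.condX t x) := hIa.sub hIs
  calc ∫ ω, ‖natVec (S.q (t + 1) ω) - p‖ ^ 2 ∂S.condX t x
      ≤ ∫ ω, (2 * (inner ℝ (natVec (S.g x) - p) (natVec (S.a t ω)) -
          inner ℝ (natVec (S.g x)) (natVec (S.s t ω))) + (‖natVec (S.g x) - p‖ ^ 2 +
          2 * inner ℝ p (vec ν) + (n * (aMax + 1)) ^ 2)) ∂S.condX t x := by
        refine integral_mono_ae (integrable_q harr hA₂ fun M => ‖natVec M - p‖ ^ 2)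
          ((hsub.const_mul 2).add (integrable_const _)) ?_
        filter_upwards [ae_q_condX hA₂] with ω h
        have := norm_sub_sq_le (S.isSchedule_s t ω) (S.queue_eq t ω) (harr.bounded t ω) hν hp
        rw [h] at this
        linarith
    _ = 2 * ((1 - ε) * inner ℝ (natVec (S.g x) - p) (vec ν) -
          ∫ ω, inner ℝ (natVec (S.g x)) (natVec (S.s t ω)) ∂S.condX t x) +
          (‖natVec (S.g x) - p‖ ^ 2 + 2 * inner ℝ p (vec ν) + (n * (aMax + 1)) ^ 2) := by
        rw [integral_add (hsub.const_mul 2) (integrable_const _), integral_const_mul,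
          integral_sub hIa hIs, h1]
        simp
    _ ≤ _ := by
        rw [inner_sub_left]
        linarith

/-- An exponential Lyapunov function from a linear drift of the second moment. The constants depend
only on the bounds. -/
theorem exists_tsum_exp_le (n aMax : ℕ) {η C : ℝ} (hη : 0 < η) (hC : 0 ≤ C) :
    ∃ θ : ℝ, 0 < θ ∧ ∃ γ K : NNReal, γ < 1 ∧ ∀ (S : SwitchSystem.{u, v} n),
      S.ArrivalAssumption aMax → S.CondA1 → S.CondA2 → ∀ F : NMat n → ℝ, (∀ M, 0 ≤ F M) →
      (∀ M M', |F M - F M'| ≤ ‖natVec M - natVec M'‖) →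
      (∀ t x, S.μ {ω | S.X t ω = x} ≠ 0 → ∫ ω, F (S.q (t + 1) ω) ^ 2 ∂S.condX t x ≤
        F (S.g x) ^ 2 - 2 * η * F (S.g x) + C) →
      ∀ x, ∑' y, S.P x y * ((Real.exp (θ * F (S.g y))).toNNReal : ENNReal) ≤
        γ * (Real.exp (θ * F (S.g x))).toNNReal + K := by
  -- `n * (aMax + 1)` bounds one step of the queues; the maximum with `η` only serves the side
  -- condition `η ≤ D`.
  obtain ⟨θ, hθ, γ, K, hγ, h⟩ := exists_exp_drift.{u} (D := max (n * (aMax + 1)) η) hη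
    (le_max_right _ _) hC
  refine ⟨θ, hθ, γ, K, hγ, fun S harr hA₁ hA₂ F hF hLip hdrift x => ?_⟩
  obtain ⟨t, ht⟩ := S.exists_measure_X_ne_zero hA₁.2.1 x
  have := isProbabilityMeasure_condX ht
  have hreal := h S.Ω (S.condX t x) (fun ω => F (S.q (t + 1) ω)) (F (S.g x)) (hF _)
    ((measurable_of_countable F).comp (S.measurable_q _)).aemeasurable ?_ (hdrift t x ht)
  · have e := tsum_P harr hA₂ ht (φ := fun M => Real.exp (θ * F M)) fun M => (Real.exp_pos _).le
    refine e.trans_le ((ENNReal.ofReal_le_ofReal hreal).trans_eq ?_)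
    rw [ENNReal.ofReal_add (by positivity) K.coe_nonneg, ENNReal.ofReal_mul γ.coe_nonneg,
      ENNReal.ofReal_coe_nnreal, ENNReal.ofReal_coe_nnreal]
    rfl
  · filter_upwards [ae_q_condX hA₂] with ω hω
    refine (hLip _ _).trans (le_max_of_le_left ?_)
    have := norm_queue_sub_le (S.isSchedule_s t ω) (S.queue_eq t ω) (harr.bounded t ω)
    rwa [hω] at this

/-- The case `p = 0`: since all entries of `ν` are at least `κ`, `⟨q, ν⟩ ≥ κ ∑ q ≥ κ ‖q‖`. The drift
vanishes with `ε`, which suffices for stability at each fixed `ε`. -/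
theorem integral_norm_sq_le (harr : S.ArrivalAssumption aMax) (hA₁ : S.CondA1) (hA₂ : S.CondA2)
    (hν : UnitSums (vec ν)) (hrate : ∀ i j, S.rate i j = (1 - ε) * ν i j) (hε : 0 < ε)
    (hW0 : 0 < W) (hW : S.DriftCondition ν W) {κ : ℝ} (hκ0 : 0 < κ) (hκ : ∀ i j, κ ≤ ν i j)
    {t : ℕ} {x : S.A} (hx : S.μ {ω | S.X t ω = x} ≠ 0) :
    ∫ ω, ‖natVec (S.q (t + 1) ω)‖ ^ 2 ∂S.condX t x ≤ ‖natVec (S.g x)‖ ^ 2 -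
      2 * (ε * κ) * ‖natVec (S.g x)‖ + (n * (aMax + 1)) ^ 2 := by
  have h := integral_norm_sub_sq_le harr hA₁ hA₂ hν hrate hW hx zero_mem_coneK
  simp only [sub_zero] at h
  have h1 : κ * ‖natVec (S.g x)‖ ≤ inner ℝ (natVec (S.g x)) (vec ν) := by
    refine (mul_le_mul_of_nonneg_left (norm_natVec_le_total _) hκ0.le).trans ?_
    rw [inner_eq_sum, total, Finset.mul_sum]
    refine Finset.sum_le_sum fun i _ => ?_
    rw [Finset.mul_sum]
    refine Finset.sum_le_sum fun j _ => ?_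
    rw [mul_comm]
    exact mul_le_mul_of_nonneg_left (hκ i j) (natVec_nonneg _ _)
  have h2 : 0 ≤ W * ‖perpK (natVec (S.g x))‖ := by positivity
  have h3 := mul_le_mul_of_nonneg_left h1 hε.le
  linarith

/-- Take `p` to be the projection of the present queue, which is still a competitor for the next
distance to the cone. Half of `W` absorbs `ε ⟨q_⊥, ν⟩`, so the drift is uniform in `ε`. -/
theorem integral_norm_perpK_sq_le (harr : S.ArrivalAssumption aMax) (hA₁ : S.CondA1)
    (hA₂ : S.CondA2) (hν : UnitSums (vec ν)) (hrate : ∀ i j, S.rate i j = (1 - ε) * ν i j)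
    (hε : 0 < ε) (hεW : ε * ‖vec ν‖ ≤ W / 2) (hW : S.DriftCondition ν W)
    {t : ℕ} {x : S.A} (hx : S.μ {ω | S.X t ω = x} ≠ 0) :
    ∫ ω, ‖perpK (natVec (S.q (t + 1) ω))‖ ^ 2 ∂S.condX t x ≤ ‖perpK (natVec (S.g x))‖ ^ 2 -
      2 * (W / 2) * ‖perpK (natVec (S.g x))‖ + (n * (aMax + 1)) ^ 2 := by
  have := isProbabilityMeasure_condX hx
  have hp := projK_mem (natVec (S.g x))
  have h := integral_norm_sub_sq_le harr hA₁ hA₂ hν hrate hW hx hp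
  have h0 : natVec (S.g x) - projK (natVec (S.g x)) = perpK (natVec (S.g x)) := rfl
  rw [h0] at h
  have h1 : - (‖perpK (natVec (S.g x))‖ * ‖vec ν‖) ≤ inner ℝ (perpK (natVec (S.g x))) (vec ν) :=
    (abs_le.1 (abs_real_inner_le_norm _ _)).1
  have h2 := mul_le_mul_of_nonneg_left h1 hε.le
  have h3 := mul_le_mul_of_nonneg_right hεW (norm_nonneg (perpK (natVec (S.g x))))
  have h4 : ∫ ω, ‖perpK (natVec (S.q (t + 1) ω))‖ ^ 2 ∂S.condX t x ≤
      ∫ ω, ‖natVec (S.q (t + 1) ω) - projK (natVec (S.g x))‖ ^ 2 ∂S.condX t x :=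
    integral_mono (integrable_q harr hA₂ fun M => ‖perpK (natVec M)‖ ^ 2)
      (integrable_q harr hA₂ fun M => ‖natVec M - projK (natVec (S.g x))‖ ^ 2)
      fun ω => pow_le_pow_left₀ (norm_nonneg _) (norm_perpK_le hp) 2
  nlinarith

/-! ### Steady-state law and its moments -/

/-- The law of the queue lengths under a distribution of the state. -/
def queueLaw (S : SwitchSystem.{u, v} n) (π : PMF S.A) : ProbabilityMeasure (NMat n) :=
  ⟨π.toMeasure.map S.g, Measure.isProbabilityMeasure_map (measurable_of_countable _).aemeasurable⟩

theorem integral_queueLaw (π : PMF S.A) (φ : NMat n → ℝ) :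
    ∫ m, φ m ∂(S.queueLaw π : Measure (NMat n)) = ∫ y, φ (S.g y) ∂π.toMeasure :=
  integral_map (measurable_of_countable _).aemeasurable
    (measurable_of_countable φ).aestronglyMeasurable

theorem integrable_queueLaw (π : PMF S.A) {φ : NMat n → ℝ}
    (h : Integrable (fun y => φ (S.g y)) π.toMeasure) :
    Integrable φ (S.queueLaw π : Measure (NMat n)) :=
  (integrable_map_measure (measurable_of_countable φ).aestronglyMeasurable
    (measurable_of_countable _).aemeasurable).2 h

/-- By the portmanteau theorem it is enough to bound open sets from below in the limit, which is
Fatou's lemma for indicators. -/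
theorem isSteadyState_queueLaw (hA₂ : S.CondA2) {π : PMF S.A}
    (hπ : ∀ x y, Tendsto (fun k => stepDist S.P k x y) atTop (𝓝 (π y))) :
    S.IsSteadyState (S.queueLaw π) := by
  classical
  refine ⟨fun t => (S.measurable_q t).aemeasurable, aemeasurable_id, ?_⟩
  refine tendsto_of_forall_isOpen_le_liminf' fun G hG => ?_
  have hGm : MeasurableSet G := hG.measurableSet
  have hl := tsum_le_liminf_stepExp hπ S.initDist (f := (S.g ⁻¹' G).indicator 1)
    (fun y => by by_cases hy : y ∈ S.g ⁻¹' G <;> simp [hy])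
  have e1 : ∑' y, π y * (S.g ⁻¹' G).indicator 1 y = π.toMeasure (S.g ⁻¹' G) := by
    rw [← lintegral_toMeasure, lintegral_indicator_one MeasurableSet.of_discrete]
  have e2 : ∀ t, ∑' x, S.initDist x * stepExp S.P t ((S.g ⁻¹' G).indicator 1) x =
      S.μ (S.q t ⁻¹' G) := by
    intro t
    simp only [stepExp]
    rw [← tsum_bind_mul, ← lintegral_toMeasure, lintegral_indicator_one MeasurableSet.of_discrete]
    have : (S.initDist.bind (stepDist S.P t)).toMeasure = S.μ.map (S.X t) := by
      refine Measure.ext_of_singleton fun y => ?_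
      rw [PMF.toMeasure_apply_singleton _ _ MeasurableSet.of_discrete, ← measure_X,
        Measure.map_apply (S.measurable_X t) MeasurableSet.of_discrete]
      rfl
    rw [this, Measure.map_apply (S.measurable_X t) MeasurableSet.of_discrete]
    congr 1
    ext ω
    simp [hA₂.1]
  rw [e1] at hl
  simp only [e2] at hl
  have e3 : (Measure.map id (S.queueLaw π : Measure (NMat n))) G = π.toMeasure (S.g ⁻¹' G) := by
    rw [Measure.map_id]
    exact Measure.map_apply (measurable_of_countable _) hGm
  have e4 : ∀ t, (Measure.map (S.q t) S.μ) G = S.μ (S.q t ⁻¹' G) := fun t =>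
    Measure.map_apply (S.measurable_q t) hGm
  simpa only [ProbabilityMeasure.coe_mk, e3, e4] using hl

theorem exists_stationary (hn : 0 < n) (harr : S.ArrivalAssumption aMax) (hA₁ : S.CondA1)
    (hA₂ : S.CondA2) (hν : UnitSums (vec ν)) (hpos : ∀ i j, 0 < ν i j)
    (hrate : ∀ i j, S.rate i j = (1 - ε) * ν i j) (hε : 0 < ε) (hW0 : 0 < W)
    (hW : S.DriftCondition ν W) :
    S.Stable ∧ ∃ π : PMF S.A, (∀ x y, Tendsto (fun k => stepDist S.P k x y) atTop (𝓝 (π y))) ∧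
      π.bind S.P = π ∧ ∀ r : ℕ, Integrable (fun y => ‖natVec (S.g y)‖ ^ r) π.toMeasure := by
  have : Nonempty (Fin n × Fin n) := ⟨⟨⟨0, hn⟩, ⟨0, hn⟩⟩⟩
  obtain ⟨p₀, hp₀⟩ := Finite.exists_min fun p : Fin n × Fin n => ν p.1 p.2
  have hκ : ∀ i j, ν p₀.1 p₀.2 ≤ ν i j := fun i j => hp₀ (i, j)
  have hκ0 := hpos p₀.1 p₀.2
  obtain ⟨θ, hθ, γ, K, hγ, h⟩ := exists_tsum_exp_le.{u, v} n aMax (η := ε * ν p₀.1 p₀.2)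
    (C := (n * (aMax + 1)) ^ 2) (by positivity) (by positivity)
  have hdrift := h S harr hA₁ hA₂ (fun M => ‖natVec M‖) (fun M => norm_nonneg _)
    (fun M M' => abs_norm_sub_norm_le _ _)
    (fun t x hx => integral_norm_sq_le harr hA₁ hA₂ hν hrate hε hW0 hW hκ0 hκ hx)
  have hfin : ∀ R : NNReal, {x : S.A | (Real.exp (θ * ‖natVec (S.g x)‖)).toNNReal ≤ R}.Finite := by
    intro R
    refine (hA₂.2 _ (finite_natVec_norm_le (R / θ))).subset fun x hx => ?_
    have h1 : Real.exp (θ * ‖natVec (S.g x)‖) ≤ R := Real.toNNReal_le_iff_le_coe.1 hx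
    have h2 := Real.add_one_le_exp (θ * ‖natVec (S.g x)‖)
    change ‖natVec (S.g x)‖ ≤ R / θ
    rw [le_div_iff₀ hθ]
    linarith
  have : Nonempty S.A := ⟨S.initDist.support_nonempty.some⟩
  refine ⟨positiveRecurrent_of_drift hA₁.2.1 hA₁.2.2 hγ hdrift hfin, ?_⟩
  obtain ⟨π, hπ, hinv⟩ := Switch.exists_stationary hA₁.2.1 hA₁.2.2 hγ hdrift hfin
  refine ⟨π, hπ, hinv, fun r => ?_⟩
  obtain ⟨K', hK'⟩ := exists_drift_fixedPoint hγ K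
  have hexp := tsum_stationary_le_of_drift hπ hγ hK'.le hdrift
  rw [← lintegral_toMeasure] at hexp
  have hint : Integrable (fun y => Real.exp (θ * ‖natVec (S.g y)‖)) π.toMeasure := by
    refine ⟨(measurable_of_countable _).aestronglyMeasurable, ?_⟩
    rw [hasFiniteIntegral_iff_ofReal (Eventually.of_forall fun y => (Real.exp_pos _).le)]
    exact hexp.trans_lt (by simp)
  refine (hint.const_mul (r.factorial / θ ^ r)).mono'
    (measurable_of_countable _).aestronglyMeasurable (Eventually.of_forall fun y => ?_)
  rw [Real.norm_of_nonneg (by positivity)]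
  exact pow_le_mul_exp hθ (norm_nonneg _) r

/-- Bounds on the moments of `‖q̄_{⊥𝒦}‖` that depend only on `n`, `aMax` and `W`. -/
theorem exists_moment_bound (n aMax : ℕ) (hW0 : 0 < W) :
    ∃ C : ℕ → ℝ, ∀ (S : SwitchSystem.{u, v} n) (ν : Matrix (Fin n) (Fin n) ℝ) (ε : ℝ),
      S.ArrivalAssumption aMax → S.CondA1 → S.CondA2 → UnitSums (vec ν) →
      (∀ i j, S.rate i j = (1 - ε) * ν i j) → 0 < ε → ε * ‖vec ν‖ ≤ W / 2 →
      S.DriftCondition ν W → ∀ π : PMF S.A,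
      (∀ x y, Tendsto (fun k => stepDist S.P k x y) atTop (𝓝 (π y))) → ∀ r : ℕ,
      Integrable (fun y => ‖perpK (natVec (S.g y))‖ ^ r) π.toMeasure ∧
        ∫ y, ‖perpK (natVec (S.g y))‖ ^ r ∂π.toMeasure ≤ C r := by
  obtain ⟨θ, hθ, γ, K, hγ, h⟩ := exists_tsum_exp_le.{u, v} n aMax (η := W / 2)
    (C := (n * (aMax + 1)) ^ 2) (by positivity) (by positivity)
  obtain ⟨K', hK'⟩ := exists_drift_fixedPoint hγ K
  refine ⟨fun r => r.factorial / θ ^ r * K', fun S ν ε harr hA₁ hA₂ hν hrate hε hεW hW π hπ r => ?_⟩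
  have hdrift := h S harr hA₁ hA₂ (fun M => ‖perpK (natVec M)‖) (fun M => norm_nonneg _)
    (fun M M' => abs_norm_perpK_sub_le _ _)
    (fun t x hx => integral_norm_perpK_sq_le harr hA₁ hA₂ hν hrate hε hεW hW hx)
  have hexp := tsum_stationary_le_of_drift hπ hγ hK'.le hdrift
  rw [← lintegral_toMeasure] at hexp
  have hint : Integrable (fun y => Real.exp (θ * ‖perpK (natVec (S.g y))‖)) π.toMeasure := by
    refine ⟨(measurable_of_countable _).aestronglyMeasurable, ?_⟩
    rw [hasFiniteIntegral_iff_ofReal (Eventually.of_forall fun y => (Real.exp_pos _).le)]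
    exact hexp.trans_lt (by simp)
  have hle : ∫ y, Real.exp (θ * ‖perpK (natVec (S.g y))‖) ∂π.toMeasure ≤ K' := by
    rw [integral_eq_lintegral_of_nonneg_ae (Eventually.of_forall fun y => (Real.exp_pos _).le)
      hint.1]
    exact ENNReal.toReal_le_of_le_ofReal K'.coe_nonneg
      (hexp.trans_eq (ENNReal.ofReal_coe_nnreal).symm)
  have hpow : Integrable (fun y => ‖perpK (natVec (S.g y))‖ ^ r) π.toMeasure := by
    refine (hint.const_mul (r.factorial / θ ^ r)).mono'
      (measurable_of_countable _).aestronglyMeasurable (Eventually.of_forall fun y => ?_)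
    rw [Real.norm_of_nonneg (by positivity)]
    exact pow_le_mul_exp hθ (norm_nonneg _) r
  refine ⟨hpow, ?_⟩
  calc ∫ y, ‖perpK (natVec (S.g y))‖ ^ r ∂π.toMeasure
      ≤ ∫ y, r.factorial / θ ^ r * Real.exp (θ * ‖perpK (natVec (S.g y))‖) ∂π.toMeasure :=
        integral_mono hpow (hint.const_mul _) fun y => pow_le_mul_exp hθ (norm_nonneg _) r
    _ = r.factorial / θ ^ r * ∫ y, Real.exp (θ * ‖perpK (natVec (S.g y))‖) ∂π.toMeasure :=
        integral_const_mul _ _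
    _ ≤ _ := mul_le_mul_of_nonneg_left hle (by positivity)

end SwitchSystem

/-! ### Mean queue length in heavy traffic -/

namespace SwitchSystem

variable {n : ℕ} {S : SwitchSystem.{u, v} n} {ν : Matrix (Fin n) (Fin n) ℝ} {aMax : ℕ} {ε : ℝ}

/-- The second moment of the projected arrivals. -/
theorem integral_inner_projS_a (hn : 0 < n) (harr : S.ArrivalAssumption aMax)
    (hν : UnitSums (vec ν)) (hrate : ∀ i j, S.rate i j = (1 - ε) * ν i j) (t : ℕ) :
    ∫ ω, inner ℝ (projS n (natVec (S.a t ω) - vec ν)) (natVec (S.a t ω) - vec ν) ∂S.μ =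
      (2 * n - 1) / (n : ℝ) ^ 2 * ∑ i, ∑ j, S.arrivalVar i j + ε ^ 2 := by
  have hn' : (n : ℝ) ≠ 0 := by positivity
  have hν1 : ∀ i, ∑ j, ν i j = 1 := hν.1
  have hν2 : ∀ j, ∑ i, ν i j = 1 := hν.2
  have hrow : ∀ i, ∫ ω, (∑ k, (S.a t ω i k : ℝ) - 1) ^ 2 ∂S.μ =
      ∑ k, S.arrivalVar i k + ε ^ 2 := by
    intro i
    have := integral_sum_sub_sq (t := t) harr ({i} ×ˢ Finset.univ) 1
    simp only [Finset.sum_product, Finset.sum_singleton] at this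
    rw [this]
    simp only [hrate, ← Finset.mul_sum, hν1]
    ring
  have hcol : ∀ j, ∫ ω, (∑ k, (S.a t ω k j : ℝ) - 1) ^ 2 ∂S.μ =
      ∑ k, S.arrivalVar k j + ε ^ 2 := by
    intro j
    have := integral_sum_sub_sq (t := t) harr (Finset.univ ×ˢ {j}) 1
    simp only [Finset.sum_product, Finset.sum_singleton] at this
    rw [this]
    simp only [hrate, ← Finset.mul_sum, hν2]
    ring
  have htot : ∫ ω, (∑ k, ∑ l, (S.a t ω k l : ℝ) - n) ^ 2 ∂S.μ =
      ∑ k, ∑ l, S.arrivalVar k l + (n * ε) ^ 2 := by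
    have := integral_sum_sub_sq (t := t) harr (Finset.univ ×ˢ Finset.univ) n
    simp only [Finset.sum_product] at this
    rw [this]
    simp only [hrate, ← Finset.mul_sum, hν1, Finset.sum_const, Finset.card_univ,
      Fintype.card_fin, nsmul_eq_mul]
    ring
  have hexp : ∀ M : NMat n, inner ℝ (projS n (natVec M - vec ν)) (natVec M - vec ν) =
      (∑ i, (∑ k, (M i k : ℝ) - 1) ^ 2) / n + (∑ j, (∑ k, (M k j : ℝ) - 1) ^ 2) / n -
        (∑ k, ∑ l, (M k l : ℝ) - n) ^ 2 / (n : ℝ) ^ 2 := by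
    intro M
    have h1 : ∀ i j, (natVec M - vec ν) (i, j) = (M i j : ℝ) - ν i j := fun i j => rfl
    rw [inner_projS]
    simp only [total, h1, Finset.sum_sub_distrib, hν1, hν2, Finset.sum_const, Finset.card_univ,
      Fintype.card_fin, nsmul_eq_mul, mul_one, ← sq]
  simp only [hexp]
  have hI := fun φ : NMat n → ℝ => integrable_a (t := t) harr S.μ φ
  rw [integral_sub
      (hI fun M => (∑ i, (∑ k, (M i k : ℝ) - 1) ^ 2) / n + (∑ j, (∑ k, (M k j : ℝ) - 1) ^ 2) / n)
      (hI fun M => (∑ k, ∑ l, (M k l : ℝ) - n) ^ 2 / (n : ℝ) ^ 2),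
    integral_add (hI fun M => (∑ i, (∑ k, (M i k : ℝ) - 1) ^ 2) / n)
      (hI fun M => (∑ j, (∑ k, (M k j : ℝ) - 1) ^ 2) / n),
    integral_div, integral_div, integral_div,
    integral_finsetSum _ (fun i _ => hI fun M => (∑ k, (M i k : ℝ) - 1) ^ 2),
    integral_finsetSum _ (fun j _ => hI fun M => (∑ k, (M k j : ℝ) - 1) ^ 2), htot]
  simp only [hrow, hcol, Finset.sum_add_distrib, Finset.sum_const, Finset.card_univ,
    Fintype.card_fin, nsmul_eq_mul]
  -- Each variance has weight `1/n + 1/n - 1/n²`, and the squared biases of the row sums, column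
  -- sums and total add up to `ε² + ε² - ε²`.
  rw [Finset.sum_comm (f := fun j k => S.arrivalVar k j)]
  field_simp
  ring

/-- One step of the chain, seen through the projection onto `𝒮`. -/
theorem abs_integral_projS_step_le (hn : 0 < n) (harr : S.ArrivalAssumption aMax) (hA₁ : S.CondA1)
    (hA₂ : S.CondA2) (hν : UnitSums (vec ν)) (hrate : ∀ i j, S.rate i j = (1 - ε) * ν i j)
    {c : ℝ} (hc : ∀ x : Vec n, ‖projS n x‖ ≤ c * ‖x‖) {δ : ℝ} (hδ : 0 < δ) (x : S.A) :
    |∫ y, inner ℝ (projS n (natVec (S.g y))) (natVec (S.g y)) ∂(S.P x).toMeasure -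
        inner ℝ (projS n (natVec (S.g x))) (natVec (S.g x)) +
        2 * ε / n * total (natVec (S.g x)) -
        ((2 * n - 1) / (n : ℝ) ^ 2 * ∑ i, ∑ j, S.arrivalVar i j + ε ^ 2)| ≤
      δ * ∫ y, ‖perpK (natVec (S.g y))‖ ^ 2 ∂(S.P x).toMeasure + ((1 + c) ^ 2 / δ + c) *
        (∫ y, total (natVec (S.g y)) ∂(S.P x).toMeasure - total (natVec (S.g x)) + ε * n) := by
  obtain ⟨t, hx⟩ := S.exists_measure_X_ne_zero hA₁.2.1 x
  have := isProbabilityMeasure_condX hx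
  rw [integral_P hA₂ hx fun M => inner ℝ (projS n (natVec M)) (natVec M),
    integral_P hA₂ hx fun M => ‖perpK (natVec M)‖ ^ 2,
    integral_P hA₂ hx fun M => total (natVec M)]
  set m := S.condX t x with hm
  set Q := natVec (S.g x) with hQ
  have hIq := fun φ : NMat n → ℝ => integrable_q (t := t) (x := x) harr hA₂ φ
  have hIa := fun φ : NMat n → ℝ => integrable_a (t := t) harr m φ
  have i1 : Integrable (fun ω => inner ℝ (projS n (natVec (S.q (t + 1) ω)))
      (natVec (S.q (t + 1) ω))) m := hIq fun M => inner ℝ (projS n (natVec M)) (natVec M)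
  have i2 : Integrable (fun ω => inner ℝ (projS n Q) (natVec (S.a t ω))) m :=
    hIa fun M => inner ℝ (projS n Q) (natVec M)
  have i3 : Integrable (fun ω => inner ℝ (projS n (natVec (S.a t ω) - vec ν))
      (natVec (S.a t ω) - vec ν)) m :=
    hIa fun M => inner ℝ (projS n (natVec M - vec ν)) (natVec M - vec ν)
  have i4 : Integrable (fun ω => ‖perpK (natVec (S.q (t + 1) ω))‖ ^ 2) m :=
    hIq fun M => ‖perpK (natVec M)‖ ^ 2
  have i5 : Integrable (fun ω => total (natVec (S.q (t + 1) ω))) m :=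
    hIq fun M => total (natVec M)
  have i6 : Integrable (fun ω => total (natVec (S.a t ω))) m := hIa fun M => total (natVec M)
  have v2 : ∫ ω, inner ℝ (projS n Q) (natVec (S.a t ω)) ∂m = (1 - ε) * (total Q / n) := by
    rw [hm, integral_a_condX hA₁ hx fun M => inner ℝ (projS n Q) (natVec M),
      integral_inner_a harr hrate, inner_projS_of_unitSums hn hν]
  have v3 : ∫ ω, inner ℝ (projS n (natVec (S.a t ω) - vec ν)) (natVec (S.a t ω) - vec ν) ∂m =
      (2 * n - 1) / (n : ℝ) ^ 2 * ∑ i, ∑ j, S.arrivalVar i j + ε ^ 2 := by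
    rw [hm, integral_a_condX hA₁ hx fun M => inner ℝ (projS n (natVec M - vec ν))
      (natVec M - vec ν), integral_inner_projS_a hn harr hν hrate]
  have v6 : ∫ ω, total (natVec (S.a t ω)) ∂m = (1 - ε) * n := by
    rw [hm, integral_a_condX hA₁ hx fun M => total (natVec M), integral_total_a harr hrate hν]
  have hL : ∫ ω, (inner ℝ (projS n (natVec (S.q (t + 1) ω))) (natVec (S.q (t + 1) ω)) -
      inner ℝ (projS n Q) Q - 2 * (inner ℝ (projS n Q) (natVec (S.a t ω)) - total Q / n) -
      inner ℝ (projS n (natVec (S.a t ω) - vec ν)) (natVec (S.a t ω) - vec ν)) ∂m =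
      ∫ ω, inner ℝ (projS n (natVec (S.q (t + 1) ω))) (natVec (S.q (t + 1) ω)) ∂m -
        inner ℝ (projS n Q) Q + 2 * ε / n * total Q -
        ((2 * n - 1) / (n : ℝ) ^ 2 * ∑ i, ∑ j, S.arrivalVar i j + ε ^ 2) := by
    rw [integral_sub (by fun_prop) i3, integral_sub (by fun_prop) (by fun_prop),
      integral_sub i1 (by fun_prop), integral_const_mul, integral_sub i2 (by fun_prop), v2, v3]
    simp only [integral_const, probReal_univ, smul_eq_mul, one_mul]
    ring
  have hR : ∫ ω, (δ * ‖perpK (natVec (S.q (t + 1) ω))‖ ^ 2 + ((1 + c) ^ 2 / δ + c) *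
      (total (natVec (S.q (t + 1) ω)) - total Q - total (natVec (S.a t ω)) + n)) ∂m =
      δ * ∫ ω, ‖perpK (natVec (S.q (t + 1) ω))‖ ^ 2 ∂m + ((1 + c) ^ 2 / δ + c) *
        (∫ ω, total (natVec (S.q (t + 1) ω)) ∂m - total Q + ε * n) := by
    rw [integral_add (by fun_prop) (by fun_prop), integral_const_mul, integral_const_mul,
      integral_add (by fun_prop) (by fun_prop), integral_sub (by fun_prop) i6,
      integral_sub i5 (by fun_prop), v6]
    simp only [integral_const, probReal_univ, smul_eq_mul, one_mul]
    ring
  rw [← hL, ← hR]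
  refine abs_integral_le_integral_abs.trans (integral_mono_ae (by fun_prop) (by fun_prop) ?_)
  filter_upwards [ae_q_condX hA₂] with ω h
  have := abs_inner_projS_step_le hn hc hδ (S.isSchedule_s t ω) (S.queue_eq t ω) hν
  rw [h] at this
  exact this

/-- The mean total queue length in steady state, up to an error that is controlled by the
distance to the cone. -/
theorem abs_mean_total_sub_le (hn : 0 < n) (harr : S.ArrivalAssumption aMax) (hA₁ : S.CondA1)
    (hA₂ : S.CondA2) (hν : UnitSums (vec ν)) (hrate : ∀ i j, S.rate i j = (1 - ε) * ν i j)
    {c : ℝ} (hc : ∀ x : Vec n, ‖projS n x‖ ≤ c * ‖x‖) {δ : ℝ} (hδ : 0 < δ) {π : PMF S.A}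
    (hinv : π.bind S.P = π)
    (hmom : ∀ r : ℕ, Integrable (fun y => ‖natVec (S.g y)‖ ^ r) π.toMeasure) :
    Integrable (fun y => total (natVec (S.g y))) π.toMeasure ∧
    |2 * ε / n * ∫ y, total (natVec (S.g y)) ∂π.toMeasure -
        ((2 * n - 1) / (n : ℝ) ^ 2 * ∑ i, ∑ j, S.arrivalVar i j + ε ^ 2)| ≤
      δ * ∫ y, ‖perpK (natVec (S.g y))‖ ^ 2 ∂π.toMeasure +
        ((1 + c) ^ 2 / δ + c) * (ε * n) := by
  have j1 : Integrable (fun y => total (natVec (S.g y))) π.toMeasure := by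
    refine ((hmom 1).const_mul ((n : ℝ) ^ 2)).mono'
      (measurable_of_countable _).aestronglyMeasurable (Eventually.of_forall fun y => ?_)
    rw [Real.norm_of_nonneg ((norm_nonneg _).trans (norm_natVec_le_total _)), pow_one]
    exact total_natVec_le _
  have j2 : Integrable (fun y => inner ℝ (projS n (natVec (S.g y))) (natVec (S.g y)))
      π.toMeasure := by
    refine ((hmom 2).const_mul c).mono'
      (measurable_of_countable _).aestronglyMeasurable (Eventually.of_forall fun y => ?_)
    have h1 := abs_real_inner_le_norm (projS n (natVec (S.g y))) (natVec (S.g y))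
    have h2 := mul_le_mul_of_nonneg_right (hc (natVec (S.g y))) (norm_nonneg (natVec (S.g y)))
    rw [Real.norm_eq_abs]
    nlinarith
  have j3 : Integrable (fun y => ‖perpK (natVec (S.g y))‖ ^ 2) π.toMeasure := by
    refine (hmom 2).mono'
      (measurable_of_countable _).aestronglyMeasurable (Eventually.of_forall fun y => ?_)
    rw [Real.norm_of_nonneg (by positivity)]
    exact pow_le_pow_left₀ (norm_nonneg _) (norm_perpK_le_norm _) 2
  -- Invariance cancels the differences between successive steps. This needs integrability of the
  -- quadratic form, which comes from the second moment of `‖q‖`.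
  obtain ⟨k1, e1⟩ := integral_invariant hinv j1
  obtain ⟨k2, e2⟩ := integral_invariant hinv j2
  obtain ⟨k3, e3⟩ := integral_invariant hinv j3
  refine ⟨j1, ?_⟩
  have hstep := abs_integral_projS_step_le hn harr hA₁ hA₂ hν hrate hc hδ
  set B := (2 * n - 1) / (n : ℝ) ^ 2 * ∑ i, ∑ j, S.arrivalVar i j + ε ^ 2
  have hL : ∫ x, (∫ y, inner ℝ (projS n (natVec (S.g y))) (natVec (S.g y)) ∂(S.P x).toMeasure -
        inner ℝ (projS n (natVec (S.g x))) (natVec (S.g x)) +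
        2 * ε / n * total (natVec (S.g x)) - B) ∂π.toMeasure =
      2 * ε / n * ∫ y, total (natVec (S.g y)) ∂π.toMeasure - B := by
    rw [integral_sub (by fun_prop) (by fun_prop), integral_add (by fun_prop) (by fun_prop),
      integral_sub k2 j2, integral_const_mul, e2]
    simp
  have hR : ∫ x, (δ * ∫ y, ‖perpK (natVec (S.g y))‖ ^ 2 ∂(S.P x).toMeasure +
        ((1 + c) ^ 2 / δ + c) * (∫ y, total (natVec (S.g y)) ∂(S.P x).toMeasure -
          total (natVec (S.g x)) + ε * n)) ∂π.toMeasure =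
      δ * ∫ y, ‖perpK (natVec (S.g y))‖ ^ 2 ∂π.toMeasure +
        ((1 + c) ^ 2 / δ + c) * (ε * n) := by
    rw [integral_add (by fun_prop) (by fun_prop), integral_const_mul, integral_const_mul,
      integral_add (by fun_prop) (by fun_prop), integral_sub k1 j1, e1, e3]
    simp
  rw [← hL, ← hR]
  exact abs_integral_le_integral_abs.trans (integral_mono (by fun_prop) (by fun_prop) hstep)

end SwitchSystem

/-- The heavy-traffic limit from the bounds for the single systems. -/
theorem tendsto_of_abs_sub_le {n : ℕ} (hn : 0 < n) {m v : ℝ → ℝ} {s c C ε₀ : ℝ} (hε₀ : 0 < ε₀)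
    (hv : Tendsto v (𝓝[>] 0) (𝓝 s))
    (h : ∀ ε, 0 < ε → ε ≤ ε₀ → |2 * ε / n * m ε - ((2 * n - 1) / (n : ℝ) ^ 2 * v ε + ε ^ 2)| ≤
      √ε * C + ((1 + c) ^ 2 / √ε + c) * (ε * n)) :
    Tendsto (fun ε => ε * m ε) (𝓝[>] 0) (𝓝 ((1 - 1 / (2 * (n : ℝ))) * s)) := by
  have hn' : (n : ℝ) ≠ 0 := by positivity
  have hid : Tendsto (fun ε : ℝ => ε) (𝓝[>] 0) (𝓝 0) := tendsto_id.mono_left nhdsWithin_le_nhds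
  have hsq : Tendsto (fun ε : ℝ => √ε) (𝓝[>] 0) (𝓝 0) := by
    simpa using (Real.continuous_sqrt.tendsto 0).mono_left nhdsWithin_le_nhds
  have hB : Tendsto (fun ε => n / 2 * ((2 * n - 1) / (n : ℝ) ^ 2 * v ε + ε ^ 2)) (𝓝[>] 0)
      (𝓝 ((1 - 1 / (2 * (n : ℝ))) * s)) := by
    have := ((hv.const_mul ((2 * n - 1) / (n : ℝ) ^ 2)).add (hid.pow 2)).const_mul ((n : ℝ) / 2)
    convert! this using 2
    field_simp
    ring
  have hE : Tendsto (fun ε => n / 2 * (√ε * C + ((1 + c) ^ 2 * √ε * n + c * ε * n))) (𝓝[>] 0)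
      (𝓝 0) := by
    have := ((hsq.mul_const C).add (((hsq.const_mul ((1 + c) ^ 2)).mul_const (n : ℝ)).add
      ((hid.const_mul c).mul_const (n : ℝ)))).const_mul ((n : ℝ) / 2)
    simpa using this
  have hdiff : Tendsto (fun ε => ε * m ε - n / 2 * ((2 * n - 1) / (n : ℝ) ^ 2 * v ε + ε ^ 2))
      (𝓝[>] 0) (𝓝 0) := by
    refine squeeze_zero_norm' ?_ hE
    filter_upwards [Ioc_mem_nhdsGT hε₀] with ε hε
    have h1 := h ε hε.1 hε.2
    have e1 : ε * m ε - n / 2 * ((2 * n - 1) / (n : ℝ) ^ 2 * v ε + ε ^ 2) =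
        n / 2 * (2 * ε / n * m ε - ((2 * n - 1) / (n : ℝ) ^ 2 * v ε + ε ^ 2)) := by
      field_simp
    -- Since `ε / √ε = √ε`, the large Young coefficient times the mean unused service `ε n` still
    -- vanishes.
    have e2 : ((1 + c) ^ 2 / √ε + c) * (ε * n) = (1 + c) ^ 2 * √ε * n + c * ε * n := by
      have : (1 + c) ^ 2 / √ε * ε = (1 + c) ^ 2 * (ε / √ε) := by ring
      rw [Real.div_sqrt] at this
      linear_combination (n : ℝ) * this
    rw [Real.norm_eq_abs, e1, abs_mul, abs_of_nonneg (by positivity : (0 : ℝ) ≤ n / 2), ← e2]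
    exact mul_le_mul_of_nonneg_left h1 (by positivity)
  simpa using hdiff.add hB

end Switch

end

theorem mainTheorem1 {n : ℕ} (hn : 0 < n)
    (S : ℝ → Switch.SwitchSystem.{u, v} n) (ν : Matrix (Fin n) (Fin n) ℝ)
    (σt : Fin n → Fin n → ℝ) (aMax : ℕ)
    (harr : ∀ ε ∈ Set.Ioo (0 : ℝ) 1, (S ε).ArrivalAssumption aMax)
    (hheavy : Switch.HeavyTraffic S ν σt)
    (hclass : Switch.InClassOne S ν) :
    Switch.AchievesSSC S ∧ Switch.MaxWeightLike S σt := by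
  open Switch SwitchSystem in
  obtain ⟨hA, W, hW0, hW⟩ := hclass
  have hν := unitSums_of_mem_doublyStochastic hheavy.doublyStoch
  have hstat := fun ε (hε : ε ∈ Set.Ioo (0 : ℝ) 1) =>
    SwitchSystem.exists_stationary hn (harr ε hε) (hA ε hε).1 (hA ε hε).2 hν hheavy.pos
      (hheavy.rate_eq ε hε) hε.1 hW0 (hW ε hε)
  obtain ⟨C, hC⟩ := exists_moment_bound.{u, v} n aMax hW0
  obtain ⟨c, hc⟩ := exists_norm_projS_le n
  obtain ⟨ε₀, hε₀0, hε₀1, hε₀⟩ : ∃ ε₀ : ℝ, 0 < ε₀ ∧ ε₀ < 1 ∧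
      ∀ ε, 0 < ε → ε ≤ ε₀ → ε * ‖vec ν‖ ≤ W / 2 := by
    -- The second entry lets the drift `W` dominate the perturbation by `ε`; the first keeps all `ε
    -- ≤ ε₀` inside the interval where the family is controlled.
    refine ⟨min (1 / 2) (W / (2 * (‖vec ν‖ + 1))), by positivity,
      (min_le_left _ _).trans_lt (by norm_num), fun ε hε h => ?_⟩
    have h1 := h.trans (min_le_right _ _)
    rw [le_div_iff₀ (by positivity)] at h1
    nlinarith [norm_nonneg (vec ν)]
  have hsteady : ∀ ε ∈ Set.Ioo (0 : ℝ) 1, ∃ ρ : ProbabilityMeasure (NMat n),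
      (S ε).IsSteadyState ρ ∧
      Integrable (fun m : NMat n => ∑ i, ∑ j, (m i j : ℝ)) (ρ : Measure (NMat n)) ∧
      (ε ≤ ε₀ → (∀ r : ℕ, Integrable (fun m => ‖perpK (natVec m)‖ ^ r) (ρ : Measure (NMat n)) ∧
        ∫ m, ‖perpK (natVec m)‖ ^ r ∂(ρ : Measure (NMat n)) ≤ C r) ∧
        |2 * ε / n * ∫ m : NMat n, ∑ i, ∑ j, (m i j : ℝ) ∂(ρ : Measure (NMat n)) -
          ((2 * n - 1) / (n : ℝ) ^ 2 * ∑ i, ∑ j, (S ε).arrivalVar i j + ε ^ 2)| ≤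
          √ε * C 2 + ((1 + c) ^ 2 / √ε + c) * (ε * n)) := by
    intro ε hε
    obtain ⟨-, π, hπ, hinv, hmom⟩ := hstat ε hε
    -- The Young weight `√ε` balances the two error terms `δ ‖q_⊥‖²` and `ε / δ`.
    have hδ : 0 < √ε := Real.sqrt_pos.2 hε.1
    obtain ⟨hint, habs⟩ := abs_mean_total_sub_le hn (harr ε hε) (hA ε hε).1 (hA ε hε).2 hν
      (hheavy.rate_eq ε hε) hc hδ hinv hmom
    refine ⟨(S ε).queueLaw π, isSteadyState_queueLaw (hA ε hε).2 hπ,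
      integrable_queueLaw π (φ := fun m : NMat n => ∑ i, ∑ j, (m i j : ℝ)) hint, fun hle => ?_⟩
    have hb := hC (S ε) ν ε (harr ε hε) (hA ε hε).1 (hA ε hε).2 hν (hheavy.rate_eq ε hε) hε.1
      (hε₀ ε hε.1 hle) (hW ε hε) π hπ
    refine ⟨fun r => ⟨integrable_queueLaw π (φ := fun m => ‖perpK (natVec m)‖ ^ r) (hb r).1, ?_⟩, ?_⟩
    · rw [integral_queueLaw π fun m => ‖perpK (natVec m)‖ ^ r]
      exact (hb r).2
    · rw [integral_queueLaw π fun m : NMat n => ∑ i, ∑ j, (m i j : ℝ)]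
      refine habs.trans ?_
      gcongr
      exact (hb 2).2
  choose! ρ hρ₁ hρ₂ hρ₃ using hsteady
  refine ⟨⟨fun ε hε => ⟨(hstat ε hε).1, hA ε hε⟩, ε₀, hε₀0, C, fun ε hε hle =>
    ⟨ρ ε, hρ₁ ε hε, fun r _ => (hρ₃ ε hε hle).1 r⟩⟩, ρ, fun ε hε => ⟨hρ₁ ε hε, hρ₂ ε hε⟩, ?_⟩
  refine tendsto_of_abs_sub_le hn hε₀0 (v := fun ε => ∑ i, ∑ j, (S ε).arrivalVar i j) ?_
    fun ε h0 hle => (hρ₃ ε ⟨h0, hle.trans_lt hε₀1⟩ hle).2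
  rw [norm_sq_eq_sum]
  exact tendsto_finsetSum _ fun i _ => tendsto_finsetSum _ fun j _ => hheavy.tendsto_var i j
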